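/- Let $\Lambda=\mathbb{Z}u+\mathbb{Z}v$ be the triangular lattice ($u,v$ unit vectors at an angle of $60^\circ$). A \emph{lattice edge} is a segment between two points of $\Lambda$ that contains no other point of $\Lambda$. Let $\Omega$ be a simple closed polygon with vertices in $\Lambda$. A triangulation of $\Omega$ is a set of lattice edges lying in $\Omega$ and meeting only in lattice points, including the edges of $\Omega$, whose vertices are all the points of $\Lambda$ in $\Omega$ and whose facets in $\Omega$ are all triangles. A \emph{flip} replaces the common side of two adjacent facets that form a strictly convex quadrilateral by the other diagonal of the quadrilateral. A \emph{flip path} from a triangulation $T$ generates a set of edges $G$ if its final triangulation contains $G$; it is \emph{minimum} if no flip path from $T$ that generates $G$ has fewer flips. A \emph{flip plan} that generates $G$ from $T$ is a finite partially ordered set of flips whose linear extensions are exactly the flip paths from $T$ that generate $G$ and perform exactly the flips in the set, each once; it is \emph{minimum} if all its linear extensions are minimum flip paths. For a lattice edge $e$ write $e=xp+yq$ as a vector from an end point $a$, where $p,q$ are consecutive (anticlockwise) unit vectors of $\Lambda$ and $x,y\ge 0$ are relatively prime. Define the partially ordered set of flips $\pi_e$ recursively. If $e$ has unit length, then $\pi_e=\emptyset$.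 Otherwise let $e_1,e_2$ be the vectors, with nonnegative coordinates in $(p,q)$, that correspond to the two Farey neighbors of the fraction $\min(x,y)/\max(x,y)$ in the first Farey sequence that contains it ($e_1=p$, $e_2=q$ if $x=y=1$), so that $e_1+e_2=e$, and let $e_1$ be the longer one if the lengths differ. The maximum of $\pi_e$ is the flip that inserts $e$ in the parallelogram with vertices $a,\,a+e_1,\,a+e,\,a+e_2$ and removes the other diagonal; its children are (unless $e_1$ has unit length) the maxima of $\pi_{e_1}$ placed at $a$ and of $\pi_{e_1}$ placed at $a+e_2$, and below it $\pi_e$ consists of these two partially ordered sets, merged at common flips. For a finite set $E$ of lattice edges let $\pi_E=\bigcup_{e\in E}\pi_e$, merged at common flips (with the order generated by the orders of the $\pi_e$). \textbf{Theorem (Unique, Minimum Flip Plan for Multiple Edges).} Let $\Omega$ admit an equilateral triangulation $T_0$ (a triangulation all of whose edges have equal length), and let $E$ be a finite set of lattice edges contained in $\Omega$ any two of which meet only in lattice points. Then: 1. for each $e\in E$, $\pi_e$ is the unique minimum flip plan that generates $\{e\}$ from $T_0$; 2. $\pi_E$ is the unique minimum flip plan that generates $E$ from $T_0$; 3. for every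 ordering $e_1,\dots,e_n$ of $E$, the edges can be generated sequentially in this order: there are sequences $l_1,\dots,l_n$ such that $l_i$ is a linear extension of $\pi_{e_i}\setminus(\pi_{e_1}\cup\dots\cup\pi_{e_{i-1}})$ with the induced order, and for all such sequences the concatenation $l_1l_2\cdots l_n$ is a minimum flip path that generates $E$ from $T_0$, such that after $l_1\cdots l_k$ the triangulation contains $e_1,\dots,e_k$, for each $k\le n$. -/

import Mathlib

namespace LatticeFlip

/-! ### The triangular lattice -/

/-- A point (or vector) of the triangular lattice, in coordinates with respect to two unit vectors
`u`, `v` at an angle of 60 degrees: `(a, b)` stands for `a u + b v`. -/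
abbrev Pt := ℤ × ℤ

/-- The squared Euclidean length of the lattice vector `a u + b v`. -/
def sqLen (w : Pt) : ℤ := w.1 ^ 2 + w.1 * w.2 + w.2 ^ 2

/-- The lattice point as a point of the real plane (same coordinates; incidence, convexity and
topology do not depend on the choice of the affine coordinates). -/
def toR (p : Pt) : ℝ × ℝ := ((p.1 : ℝ), (p.2 : ℝ))

/-- Twice the signed area of the triangle `a b c`, in lattice units; positive if and only if
`a, b, c` are in anticlockwise order. -/
def orient (a b c : Pt) : ℤ := (b.1 - a.1) * (c.2 - a.2) - (b.2 - a.2) * (c.1 - a.1)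

/-- An unordered pair of lattice points, regarded as a straight line segment. -/
abbrev Edge := Sym2 Pt

/-- The closed line segment of an edge. -/
def seg (e : Edge) : Set (ℝ × ℝ) := convexHull ℝ (toR '' {p | p ∈ e})

/-- Lattice edges: the difference of the end points has relatively prime coordinates. -/
def IsEdge (e : Edge) : Prop :=
  ∃ a b : Pt, e = s(a, b) ∧ IsCoprime (b.1 - a.1) (b.2 - a.2)

/-- Two edges meet at most at lattice points. -/
def NonCrossing (e e' : Edge) : Prop :=
  ∀ x ∈ seg e ∩ seg e', ∃ p : Pt, toR p = x

/-! ### Polygons and lattice triangulations -/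

/-- A simple closed lattice polygon, given by its cyclic list of vertices. All lattice points on the
boundary are listed as vertices (the angle at a vertex may be straight). -/
structure LatticePolygon where
  n : ℕ
  three_le : 3 ≤ n
  vertex : ZMod n → Pt
  vertex_injective : Function.Injective vertex
  isEdge_side : ∀ i, IsEdge s(vertex i, vertex (i + 1))
  simple : ∀ i j, i ≠ j →
    NonCrossing s(vertex i, vertex (i + 1)) s(vertex j, vertex (j + 1))

/-- The `i`-th side of a polygon. -/
def LatticePolygon.side (Ω : LatticePolygon) (i : ZMod Ω.n) : Edge :=
  s(Ω.vertex i, Ω.vertex (i + 1))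

/-- The boundary curve of a polygon. -/
def LatticePolygon.boundary (Ω : LatticePolygon) : Set (ℝ × ℝ) := ⋃ i, seg (Ω.side i)

/-- The closed region bounded by a polygon: the boundary curve, and the points off the curve whose
connected component in the complement of the curve is bounded. -/
def LatticePolygon.region (Ω : LatticePolygon) : Set (ℝ × ℝ) :=
  Ω.boundary ∪
    {x | x ∉ Ω.boundary ∧ Bornology.IsBounded (connectedComponentIn Ω.boundaryᶜ x)}

/-- The (nondegenerate) triangle `a b c` is a triangular facet of the set of edges `T`: its sides
belong to `T`, and it contains no lattice points besides its vertices. -/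
def IsFacet (T : Set Edge) (a b c : Pt) : Prop :=
  orient a b c ≠ 0 ∧ s(a, b) ∈ T ∧ s(b, c) ∈ T ∧ s(c, a) ∈ T ∧
    ∀ p : Pt, toR p ∈ convexHull ℝ {toR a, toR b, toR c} → p = a ∨ p = b ∨ p = c

/-- `T` is the edge set of a triangulation of `Ω` whose vertices are all the lattice points in `Ω`:
a noncrossing set of lattice edges in `Ω`, including the sides of `Ω`, whose facets in `Ω` are all
triangular. -/
structure IsTriangulation (Ω : LatticePolygon) (T : Set Edge) : Prop where
  isEdge : ∀ e ∈ T, IsEdge e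
  subset_region : ∀ e ∈ T, seg e ⊆ Ω.region
  nonCrossing : ∀ e ∈ T, ∀ e' ∈ T, e ≠ e' → NonCrossing e e'
  side_mem : ∀ i, Ω.side i ∈ T
  exists_facet : ∀ x ∈ Ω.region, ∃ a b c : Pt,
    IsFacet T a b c ∧ x ∈ convexHull ℝ {toR a, toR b, toR c}

/-- Equilateral triangulations: all edges have the same length. -/
def IsEquilateralTriangulation (Ω : LatticePolygon) (T : Set Edge) : Prop :=
  IsTriangulation Ω T ∧
    ∀ a b c d : Pt, s(a, b) ∈ T → s(c, d) ∈ T → sqLen (b - a) = sqLen (d - c)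

/-! ### Flips and flip paths -/

/-- A flip, given by the diagonal that it removes and the diagonal that it inserts (these determine
the quadrilateral). -/
@[ext] structure Flip where
  old : Edge
  new : Edge

/-- The flip `f` can be performed on `T`: for some strictly convex quadrilateral `a b c d`
(in anticlockwise order) composed of two facets of `T` that share the diagonal `a c`, it replaces
this diagonal by `b d`. -/
def CanFlip (T : Set Edge) (f : Flip) : Prop :=
  ∃ a b c d : Pt, f.old = s(a, c) ∧ f.new = s(b, d) ∧
    0 < orient a b c ∧ 0 < orient b c d ∧ 0 < orient c d a ∧ 0 < orient d a b ∧
    IsFacet T a b c ∧ IsFacet T a c d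

/-- The result of a flip. -/
def applyFlip (T : Set Edge) (f : Flip) : Set Edge := (T \ {f.old}) ∪ {f.new}

/-- The result of a sequence of flips. -/
def applyFlips (T : Set Edge) (l : List Flip) : Set Edge := l.foldl applyFlip T

/-- The flips in the list can be performed one after the other, starting from `T`. -/
def IsFlipPath : Set Edge → List Flip → Prop
  | _, [] => True
  | T, f :: l => CanFlip T f ∧ IsFlipPath (applyFlip T f) l

/-- The flip path `l` from `T` generates the set of edges `G`. -/
def Generates (T G : Set Edge) (l : List Flip) : Prop :=
  IsFlipPath T l ∧ G ⊆ applyFlips T l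

/-- `l` has the minimum number of flips among the flip paths from `T` that generate `G`. -/
def IsMinFlipPath (T G : Set Edge) (l : List Flip) : Prop :=
  Generates T G l ∧ ∀ l', Generates T G l' → l.length ≤ l'.length

/-! ### Flip plans -/

/-- A set of flips with a relation; see `FlipPoset.IsPoset` for the order axioms. -/
@[ext] structure FlipPoset where
  flips : Set Flip
  le : Flip → Flip → Prop

/-- The relation is a partial order on the (finite) set of flips, and it relates no other flips. -/
structure FlipPoset.IsPoset (π : FlipPoset) : Prop where
  finite : π.flips.Finite
  mem_of_le : ∀ f g, π.le f g → f ∈ π.flips ∧ g ∈ π.flips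
  refl : ∀ f ∈ π.flips, π.le f f
  trans : ∀ f g h, π.le f g → π.le g h → π.le f h
  antisymm : ∀ f g, π.le f g → π.le g f → f = g

/-- The list `l` contains exactly the flips in `π`, each of them once. -/
def FlipPoset.ContainsExactly (π : FlipPoset) (l : List Flip) : Prop :=
  l.Nodup ∧ ∀ f, f ∈ l ↔ f ∈ π.flips

/-- `l` is a valid linear ordering of `π`: it lists the flips of `π`, and no flip is listed after
a greater one. -/
def FlipPoset.IsLinearOrdering (π : FlipPoset) (l : List Flip) : Prop :=
  π.ContainsExactly l ∧ l.Pairwise fun f g => ¬ π.le g f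

/-- `π` is a flip plan that generates `G` from `T`: the valid linear orderings of `π` are the
same as the flip paths from `T` that generate `G` and contain exactly the flips in `π`. -/
def IsFlipPlan (T G : Set Edge) (π : FlipPoset) : Prop :=
  π.IsPoset ∧ ∀ l, π.IsLinearOrdering l ↔ Generates T G l ∧ π.ContainsExactly l

/-- A flip plan all of whose valid linear orderings are minimum flip paths. -/
def IsMinFlipPlan (T G : Set Edge) (π : FlipPoset) : Prop :=
  IsFlipPlan T G π ∧ ∀ l, π.IsLinearOrdering l → IsMinFlipPath T G l

/-- `π` is the one and only minimum flip plan that generates `G` from `T`. -/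
def IsUniqueMinFlipPlan (T G : Set Edge) (π : FlipPoset) : Prop :=
  IsMinFlipPlan T G π ∧ ∀ π', IsMinFlipPlan T G π' → π' = π

/-- The partial order on `F` generated by a set of arcs (directed from child to parent). -/
def FlipPoset.ofArcs (F : Set Flip) (A : Set (Flip × Flip)) : FlipPoset where
  flips := F
  le f g := f ∈ F ∧ g ∈ F ∧ Relation.ReflTransGen (fun s t => (s, t) ∈ A) f g

/-- The flips of `π` that are not in `D`, with the induced order. -/
def FlipPoset.remove (π : FlipPoset) (D : Set Flip) : FlipPoset where
  flips := π.flips \ D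
  le f g := f ∉ D ∧ g ∉ D ∧ π.le f g

/-! ### Edges at points, and the algorithms -/

/-- The six unit vectors of the triangular lattice, in anticlockwise order. -/
def unitVec : Fin 6 → Pt := ![(1, 0), (0, 1), (-1, 1), (-1, 0), (0, -1), (1, -1)]

/-- An edge `(x, y)` at the lattice point `origin`: the segment from `origin` to
`origin + x u + y w`, where the defining coordinate pair `(u, w)` consists of two consecutive unit
vectors and `x`, `y` are relatively prime. -/
structure PlacedEdge where
  origin : Pt
  sector : Fin 6
  x : ℕ
  y : ℕ
  coprime : Nat.Coprime x y

namespace PlacedEdge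

/-- The lattice vector with coordinates `(i, j)` in the defining coordinate pair of `e`. -/
def coordVec (e : PlacedEdge) (i j : ℕ) : Pt :=
  (i : ℤ) • unitVec e.sector + (j : ℤ) • unitVec (e.sector + 1)

/-- The segment represented by the edge at a point. -/
def toEdge (e : PlacedEdge) : Edge := s(e.origin, e.origin + e.coordVec e.x e.y)

/-- The Farey-flip map at `e`, a fraction being a pair (numerator, denominator). -/
def fareyFlip (e : PlacedEdge) : ℕ × ℕ := if e.x < e.y then (e.x, e.y) else (e.y, e.x)

/-- The inverse of the Farey-flip map that belongs to `e`, with values in lattice vectors. -/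
def fareyInv (e : PlacedEdge) (f : ℕ × ℕ) : Pt :=
  if e.x < e.y then e.coordVec f.1 f.2 else e.coordVec f.2 f.1

end PlacedEdge

/-- The loop of the algorithm Farey Plan: `d` is the current fraction, `lo` and `hi` are the
fractions directly before and after it, and the first argument bounds the number of steps. -/
def fareySteps (f : ℕ × ℕ) : ℕ → ℕ × ℕ → ℕ × ℕ → ℕ × ℕ → List (ℕ × ℕ)
  | 0, _, _, _ => []
  | k + 1, lo, d, hi =>
    d :: if d = f then []
      else if d.1 * f.2 < f.1 * d.2 then fareySteps f k d (d + hi) hi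
      else fareySteps f k lo (lo + d) d

/-- The algorithm Farey Plan: empty for unit edges, and otherwise the sequence of mediants that
starts with `1/1` and leads to the fraction of `e`. (The denominators increase strictly, so the
bound on the number of steps is never active; the placeholder `1/0` above `1/1` is never used.) -/
def fareyPlan (e : PlacedEdge) : List (ℕ × ℕ) :=
  if e.x = 0 ∨ e.y = 0 then []
  else fareySteps e.fareyFlip e.fareyFlip.2 (0, 1) (1, 1) (1, 0)

/-- The flip on the Farey parallelogram, placed at `v`, of the last edge `φ f` of a Farey plan;
`C` is the rest of the plan in reverse order. One boundary edge is `φ g`, where `g` is the preceding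
fraction in the plan (`0/1` if `f = 1/1`), the other one is `φ f - φ g`; the inserted edge is the
diagonal `φ f`. -/
def rootFlip (φ : ℕ × ℕ → Pt) (f : ℕ × ℕ) (C : List (ℕ × ℕ)) (v : Pt) : Flip where
  old := s(v + φ (C.headD (0, 1)), v + (φ f - φ (C.headD (0, 1))))
  new := s(v, v + φ f)

/-- The flips in the output of the algorithm Flip Plan at the point `v`, for a reversed Farey
plan: the root flip, and recursively the flips for the two copies, at `v` and at the other end of
the shorter boundary edge, of the longer boundary edge. Duplicates are consolidated. -/
def planFlips (φ : ℕ × ℕ → Pt) : List (ℕ × ℕ) → Pt → Set Flip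
  | [], _ => ∅
  | f :: C, v => {rootFlip φ f C v} ∪ planFlips φ C v ∪
      planFlips φ C (v + (φ f - φ (C.headD (0, 1))))

/-- The arcs, from child to parent, in the output of the algorithm Flip Plan. -/
def planArcs (φ : ℕ × ℕ → Pt) : List (ℕ × ℕ) → Pt → Set (Flip × Flip)
  | [], _ => ∅
  | [_], _ => ∅
  | f :: g :: C, v =>
    {(rootFlip φ g C v, rootFlip φ f (g :: C) v),
      (rootFlip φ g C (v + (φ f - φ g)), rootFlip φ f (g :: C) v)} ∪
    planArcs φ (g :: C) v ∪ planArcs φ (g :: C) (v + (φ f - φ g))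

/-- The flips in the output of the algorithm Flip Plan on the edge `e`. -/
def flipSet (e : PlacedEdge) : Set Flip := planFlips e.fareyInv (fareyPlan e).reverse e.origin

/-- The arcs in the output of the algorithm Flip Plan on the edge `e`. -/
def arcSet (e : PlacedEdge) : Set (Flip × Flip) :=
  planArcs e.fareyInv (fareyPlan e).reverse e.origin

/-- The output of the algorithm Flip Plan on the edge `e`. -/
def flipPlan (e : PlacedEdge) : FlipPoset := .ofArcs (flipSet e) (arcSet e)

/-- The output of the algorithm Multi Flip Plan: the union of the plans of the individual edges,
merged at common flips. -/
def multiFlipPlan (E : Finset PlacedEdge) : FlipPoset :=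
  .ofArcs (⋃ e ∈ E, flipSet e) (⋃ e ∈ E, arcSet e)

/-- The blocks `l₁, …, lₙ` perform the plans of `e₁, …, eₙ` one after the other: `lᵢ` is a valid
linear ordering of the plan of `eᵢ` without the flips that were performed earlier, which are those
in `D` and those in the plans of `e₁, …, eᵢ₋₁`. -/
def IsSequentialOrdering : Set Flip → List PlacedEdge → List (List Flip) → Prop
  | _, [], [] => True
  | D, e :: es, l :: ls =>
    ((flipPlan e).remove D).IsLinearOrdering l ∧
      IsSequentialOrdering (D ∪ (flipPlan e).flips) es ls
  | _, _, _ => False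

/-- The concatenation of the blocks `l₁, …, lₙ` is a flip path from `T`, and the edges
`e₁, …, eₖ` are all present once the blocks `l₁, …, lₖ` have been performed, for each `k`. -/
def GeneratesSequentially (T : Set Edge) (es : List PlacedEdge) (ls : List (List Flip)) : Prop :=
  IsFlipPath T ls.flatten ∧
    ∀ k ≤ es.length, ∀ e ∈ es.take k, e.toEdge ∈ applyFlips T (ls.take k).flatten

end LatticeFlip

open LatticeFlip

/-!
Call a lattice basis `(s, t)` with positive inner product acute. A lattice vector that is not a unit
vector is `s + t` for exactly one unordered acute basis, so a lattice edge `e` longer than a unit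
edge is the long diagonal of exactly one Farey parallelogram. Passing repeatedly to the sides of
this parallelogram yields the ancestors of `e`; the flips of `π_e` are the Farey flips that insert
them, and ancestry is the order of `π_e`.

*Lower bound.* Flips take place in parallelograms on a lattice basis. A flip that is not a Farey
flip inserts a shorter diagonal, which is an ancestor of the edge that it removes. By induction
along a flip path from the unit triangulation, every edge that is ever present has had all its
ancestors inserted by their Farey flips, in an order compatible with ancestry.

*Validity.* An edge that crosses a side of a Farey parallelogram crosses its diagonal or has that
side as an ancestor; this is proved by the subtractive Euclidean algorithm. Hence ancestors of
noncrossing edges that cross each other are comparable, and whenever a linear extension of the plan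
reaches a flip, the four sides and the short diagonal of its parallelogram are present: no flip
performed earlier has removed them.

So every linear extension is a flip path of minimum length, and since any flip path that generates
the edges performs the flips of the plan in a compatible order, the set of flips and their order are
determined by its being a minimum flip plan.
-/

namespace LatticeFlip

/-! ### Acute bases of the lattice -/

/-- The determinant of two lattice vectors in the basis `u`, `v`. -/
def det (s t : Pt) : ℤ := s.1 * t.2 - s.2 * t.1

/-- Twice the Euclidean inner product of two lattice vectors; the factor 2 makes it integral. -/
def dot (s t : Pt) : ℤ := 2 * s.1 * t.1 + s.1 * t.2 + s.2 * t.1 + 2 * s.2 * t.2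

/-- The vectors `s`, `t` form a basis of the lattice and enclose an acute angle. These are the pairs
of sides of the Farey parallelograms, of which `s + t` is the long and `s - t` the short diagonal;
the orientation of the basis is left open. -/
def IsAcute (s t : Pt) : Prop := det s t ^ 2 = 1 ∧ 0 < dot s t

lemma det_sq_comm (s t : Pt) : det s t ^ 2 = det t s ^ 2 := by simp only [det]; ring

lemma dot_comm (s t : Pt) : dot s t = dot t s := by simp only [dot]; ring

lemma four_mul_sqLen_mul_sqLen (s t : Pt) :
    4 * (sqLen s * sqLen t) = dot s t ^ 2 + 3 * det s t ^ 2 := by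
  simp only [sqLen, dot, det]; ring

lemma sqLen_nonneg (s : Pt) : 0 ≤ sqLen s := by
  simp only [sqLen]; nlinarith [sq_nonneg (s.1 + s.2), sq_nonneg s.1, sq_nonneg s.2]

lemma sqLen_neg (s : Pt) : sqLen (-s) = sqLen s := by simp [sqLen]

lemma sqLen_sub_comm (s t : Pt) : sqLen (s - t) = sqLen (t - s) := by
  rw [← sqLen_neg, neg_sub]

lemma sqLen_add (s t : Pt) : sqLen (s + t) = sqLen s + sqLen t + dot s t := by
  simp only [sqLen, dot, Prod.fst_add, Prod.snd_add]; ring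

lemma sqLen_sub (s t : Pt) : sqLen (s - t) = sqLen s + sqLen t - dot s t := by
  simp only [sqLen, dot, Prod.fst_sub, Prod.snd_sub]; ring

lemma sqLen_pos_of_det_sq_eq_one {s t : Pt} (h : det s t ^ 2 = 1) : 0 < sqLen s := by
  have hgram := four_mul_sqLen_mul_sqLen s t
  refine (sqLen_nonneg s).lt_of_ne fun h0 => ?_
  rw [← h0, h] at hgram
  nlinarith [sq_nonneg (dot s t)]

lemma isCoprime_of_det_sq_eq_one {s t : Pt} (h : det s t ^ 2 = 1) {x y : ℤ}
    (hxy : IsCoprime x y) : IsCoprime (x • s + y • t).1 (x • s + y • t).2 := by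
  obtain ⟨u, v, huv⟩ := hxy
  refine ⟨det s t * (u * t.2 - v * s.2), det s t * (v * s.1 - u * t.1), ?_⟩
  simp only [det, Prod.fst_add, Prod.snd_add, Prod.smul_fst, Prod.smul_snd, smul_eq_mul] at *
  linear_combination huv + (u * x + v * y) * h

lemma exists_coords_of_det_sq_eq_one {s t : Pt} (h : det s t ^ 2 = 1) (w : Pt) :
    ∃ x y : ℤ, w = x • s + y • t := by
  refine ⟨det s t * det w t, det s t * det s w, ?_⟩
  simp only [det] at *
  ext <;> simp only [Prod.fst_add, Prod.snd_add, Prod.smul_fst, Prod.smul_snd, smul_eq_mul]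
  · linear_combination (-w.1) * h
  · linear_combination (-w.2) * h

lemma isCoprime_coords {s t : Pt} {x y : ℤ}
    (h : IsCoprime (x • s + y • t).1 (x • s + y • t).2) : IsCoprime x y := by
  obtain ⟨u, v, huv⟩ := h
  refine ⟨u * s.1 + v * s.2, u * t.1 + v * t.2, ?_⟩
  simp only [Prod.fst_add, Prod.snd_add, Prod.smul_fst, Prod.smul_snd, smul_eq_mul] at huv
  linear_combination huv

lemma isEdge_of_sub_eq {s t : Pt} (h : det s t ^ 2 = 1) {x y : ℤ} (hxy : IsCoprime x y) {a b : Pt}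
    (hab : b - a = x • s + y • t) : IsEdge s(a, b) := by
  refine ⟨a, b, rfl, ?_⟩
  rw [← Prod.fst_sub, ← Prod.snd_sub, hab]
  exact isCoprime_of_det_sq_eq_one h hxy

namespace IsAcute

variable {s t : Pt}

lemma symm (h : IsAcute s t) : IsAcute t s := ⟨det_sq_comm s t ▸ h.1, dot_comm s t ▸ h.2⟩

lemma neg (h : IsAcute s t) : IsAcute (-s) (-t) := by
  simpa [IsAcute, det, dot] using h

lemma sqLen_left_pos (h : IsAcute s t) : 0 < sqLen s := sqLen_pos_of_det_sq_eq_one h.1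

lemma sqLen_right_pos (h : IsAcute s t) : 0 < sqLen t := h.symm.sqLen_left_pos

lemma four_mul_sqLen_mul_sqLen (h : IsAcute s t) : 4 * (sqLen s * sqLen t) = dot s t ^ 2 + 3 := by
  rw [LatticeFlip.four_mul_sqLen_mul_sqLen, h.1, mul_one]

lemma odd_dot (h : IsAcute s t) : Odd (dot s t) := by
  rw [← Int.not_even_iff_odd]
  rintro ⟨k, hk⟩
  have hgram := h.four_mul_sqLen_mul_sqLen
  have : 4 * (sqLen s * sqLen t) = 4 * k ^ 2 + 3 := by rw [hgram, hk]; ring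
  omega

lemma add_right (h : IsAcute s t) : IsAcute s (s + t) := by
  have hdet : det s (s + t) = det s t := by simp only [det, Prod.fst_add, Prod.snd_add]; ring
  have hdot : dot s (s + t) = 2 * sqLen s + dot s t := by
    simp only [dot, sqLen, Prod.fst_add, Prod.snd_add]; ring
  have := h.2
  have := h.sqLen_left_pos
  exact ⟨hdet ▸ h.1, by omega⟩

lemma add_left (h : IsAcute s t) : IsAcute (s + t) t := by
  rw [add_comm]; exact h.symm.add_right.symm

lemma sub_left (h : IsAcute s t) (hlt : sqLen t < sqLen s) : IsAcute (s - t) t := by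
  have hdet : det (s - t) t = det s t := by simp only [det, Prod.fst_sub, Prod.snd_sub]; ring
  have hdot : dot (s - t) t = dot s t - 2 * sqLen t := by
    simp only [dot, sqLen, Prod.fst_sub, Prod.snd_sub]; ring
  refine ⟨hdet ▸ h.1, ?_⟩
  have hgram := h.four_mul_sqLen_mul_sqLen
  have hpos := h.sqLen_right_pos
  have h2 := h.2
  obtain ⟨k, hk⟩ := h.odd_dot
  rw [hdot]
  by_contra hcon
  have : dot s t ≤ 2 * sqLen t - 1 := by omega
  nlinarith

lemma sqLen_eq_one (h : IsAcute s t) (heq : sqLen s = sqLen t) : sqLen s = 1 := by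
  have hgram := h.four_mul_sqLen_mul_sqLen
  have hpos := h.sqLen_left_pos
  have h2 := h.2
  rw [← heq] at hgram
  obtain ⟨k, hk⟩ := h.odd_dot
  have : dot s t < 2 * sqLen s := by nlinarith
  have : dot s t ≤ 2 * sqLen s - 1 := by omega
  nlinarith

lemma sqLen_left_lt_add (h : IsAcute s t) : sqLen s < sqLen (s + t) := by
  rw [sqLen_add]; have := h.sqLen_right_pos; have := h.2; omega

lemma one_lt_sqLen_add (h : IsAcute s t) : 1 < sqLen (s + t) := by
  have := h.sqLen_left_lt_add; have := h.sqLen_left_pos; omega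

lemma sqLen_sub_lt_add (h : IsAcute s t) : sqLen (s - t) < sqLen (s + t) := by
  rw [sqLen_add, sqLen_sub]; have := h.2; omega

lemma sqLen_sub_eq_one (h : IsAcute s t) (hs : sqLen s = 1) (ht : sqLen t = 1) :
    sqLen (s - t) = 1 := by
  have hgram := h.four_mul_sqLen_mul_sqLen
  rw [hs, ht] at hgram
  have := h.2
  have : dot s t = 1 := by nlinarith
  rw [sqLen_sub, hs, ht, this]; norm_num

lemma sqLen_eq_one_or_exists_add (h : IsAcute s t) :
    sqLen s = 1 ∨ ∃ s' t', IsAcute s' t' ∧ s = s' + t' := by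
  induction hn : (sqLen t).toNat using Nat.strong_induction_on generalizing t with
  | _ n ih =>
    rcases lt_trichotomy (sqLen t) (sqLen s) with hlt | heq | hlt
    · exact Or.inr ⟨s - t, t, h.sub_left hlt, by abel⟩
    · exact Or.inl (h.sqLen_eq_one heq.symm)
    · have hsub := h.symm.sub_left hlt
      have hshorter := hsub.sqLen_left_lt_add
      rw [sub_add_cancel] at hshorter
      have := hsub.sqLen_left_pos
      exact ih _ (by omega) hsub.symm rfl

/-- All unimodular splittings of `s + t` have this form, up to exchanging the summands. -/
lemma eq_zero_of_isAcute_shear (h : IsAcute s t) {k : ℤ}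
    (hk : IsAcute (s + k • (s + t)) (t - k • (s + t))) : k = 0 := by
  have hdot : dot (s + k • (s + t)) (t - k • (s + t)) =
      -(2 * (k * (k + 1)) * sqLen s) - 2 * (k * (k - 1)) * sqLen t + (1 - 2 * k ^ 2) * dot s t := by
    simp only [dot, sqLen, Prod.fst_add, Prod.snd_add, Prod.fst_sub, Prod.snd_sub, Prod.smul_fst,
      Prod.smul_snd, smul_eq_mul]
    ring
  have h2 := h.2
  have hk2 := hk.2
  by_contra hne
  have h1 : 0 ≤ k * (k + 1) := by rcases lt_or_gt_of_ne hne with h | h <;> nlinarith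
  have h3 : 0 ≤ k * (k - 1) := by rcases lt_or_gt_of_ne hne with h | h <;> nlinarith
  have hsq : 0 < k ^ 2 := by positivity
  have h4 : 1 - 2 * k ^ 2 < 0 := by omega
  have := mul_nonneg h1 h.sqLen_left_pos.le
  have := mul_nonneg h3 h.sqLen_right_pos.le
  have := mul_neg_of_neg_of_pos h4 h2
  linarith

lemma eq_and_eq_or_of_add_eq_add (h : IsAcute s t) {s' t' : Pt} (h' : IsAcute s' t')
    (hadd : s + t = s' + t') : (s' = s ∧ t' = t) ∨ (s' = t ∧ t' = s) := by
  obtain ⟨x, y, hs'⟩ := exists_coords_of_det_sq_eq_one h.1 s'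
  have ht' : t' = s + t - s' := by rw [hadd]; abel
  have hdet : det s' t' ^ 2 = (x - y) ^ 2 * det s t ^ 2 := by
    rw [ht', hs']
    simp only [det, Prod.fst_add, Prod.snd_add, Prod.fst_sub, Prod.snd_sub, Prod.smul_fst,
      Prod.smul_snd, smul_eq_mul]
    ring
  rw [h.1, h'.1, mul_one] at hdet
  rcases sq_eq_one_iff.mp hdet.symm with hxy | hxy
  · obtain rfl : x = y + 1 := by omega
    have hs : s' = s + y • (s + t) := by rw [hs']; module
    have ht : t' = t - y • (s + t) := by rw [ht', hs]; module
    obtain rfl := h.eq_zero_of_isAcute_shear (hs ▸ ht ▸ h')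
    left; simp [hs, ht]
  · obtain rfl : y = x + 1 := by omega
    have hs : s' = t + x • (t + s) := by rw [hs']; module
    have ht : t' = s - x • (t + s) := by rw [ht', hs]; module
    obtain rfl := h.symm.eq_zero_of_isAcute_shear (hs ▸ ht ▸ h')
    right; simp [hs, ht]

end IsAcute

/-! ### Sides of Farey parallelograms -/

/-- `g` is a side of the Farey parallelogram of `e`, the parallelogram on an acute basis with long
diagonal `e`. Reversing both edges accounts for the two sides at the other end point of `e`. -/
def IsFareySide (g e : Edge) : Prop :=
  ∃ a s t : Pt, IsAcute s t ∧ g = s(a, a + s) ∧ e = s(a, a + (s + t))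

/-- `g` is reached from `e` by passing repeatedly to a side of the Farey parallelogram; these are
the edges inserted by `π_e`, and their unit sides. -/
def IsAncestor : Edge → Edge → Prop := Relation.ReflTransGen IsFareySide

/-- The squared length of an edge. -/
def edgeLen : Edge → ℤ := Sym2.lift ⟨fun a b => sqLen (b - a), fun a b => sqLen_sub_comm b a⟩

@[simp] lemma edgeLen_mk (a b : Pt) : edgeLen s(a, b) = sqLen (b - a) := rfl

lemma edge_congr {a b c d : Pt} (h : a = c) (h' : b = d) : s(a, b) = s(c, d) := by rw [h, h']

lemma edge_congr_swap {a b c d : Pt} (h : a = d) (h' : b = c) : s(a, b) = s(c, d) := by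
  rw [h, h', Sym2.eq_swap]

namespace IsAcute

variable {s t a b c : Pt}

lemma isFareySide_left (h : IsAcute s t) (hb : b = a + s) (hc : c = a + (s + t)) :
    IsFareySide s(a, b) s(a, c) := ⟨a, s, t, h, by rw [hb], by rw [hc]⟩

lemma isFareySide_right (h : IsAcute s t) (hb : b = a + s) (hc : c = a + (s + t)) :
    IsFareySide s(b, c) s(a, c) :=
  ⟨c, -t, -s, h.symm.neg, edge_congr_swap (by rw [hb, hc]; abel) rfl,
    edge_congr_swap (by rw [hc]; abel) rfl⟩

lemma parallelogram_unique {s' t' a' : Pt} (h : IsAcute s t) (h' : IsAcute s' t')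
    (he : s(a', a' + (s' + t')) = s(a, a + (s + t))) :
    (a' = a ∧ s' = s ∧ t' = t) ∨ (a' = a ∧ s' = t ∧ t' = s) ∨
      (a' = a + (s + t) ∧ s' = -s ∧ t' = -t) ∨ (a' = a + (s + t) ∧ s' = -t ∧ t' = -s) := by
  rw [Sym2.eq_iff] at he
  rcases he with ⟨rfl, he⟩ | ⟨rfl, he⟩
  · rcases h.eq_and_eq_or_of_add_eq_add h' (add_left_cancel he).symm with h | h <;> simp [h]
  · have hneg : -s + -t = s' + t' := by
      rw [← neg_add]
      exact neg_eq_of_add_eq_zero_right (by simpa only [add_assoc, add_eq_left] using he)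
    rcases h.neg.eq_and_eq_or_of_add_eq_add h' hneg with h | h <;> simp [h]

lemma isFareySide_iff (h : IsAcute s t) (k : Edge) :
    IsFareySide k s(a, a + (s + t)) ↔ k = s(a, a + s) ∨ k = s(a, a + t) ∨
      k = s(a + s, a + s + t) ∨ k = s(a + t, a + t + s) := by
  constructor
  · rintro ⟨a', s', t', h', rfl, he⟩
    rcases h.parallelogram_unique h' he.symm with ⟨rfl, rfl, rfl⟩ | ⟨rfl, rfl, rfl⟩ |
      ⟨rfl, rfl, rfl⟩ | ⟨rfl, rfl, rfl⟩
    · simp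
    · simp
    · exact Or.inr (Or.inr (Or.inr (edge_congr_swap (by abel) (by abel))))
    · exact Or.inr (Or.inr (Or.inl (edge_congr_swap (by abel) (by abel))))
  · rintro (rfl | rfl | rfl | rfl)
    · exact h.isFareySide_left rfl rfl
    · exact h.symm.isFareySide_left rfl (by abel)
    · rw [add_assoc]
      exact h.isFareySide_right rfl rfl
    · rw [add_assoc, add_comm s t]
      exact h.symm.isFareySide_right rfl rfl

end IsAcute

namespace IsFareySide

variable {g e : Edge}

lemma edgeLen_lt (h : IsFareySide g e) : edgeLen g < edgeLen e := by
  obtain ⟨a, s, t, h, rfl, rfl⟩ := h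
  simpa using h.sqLen_left_lt_add

lemma edgeLen_pos (h : IsFareySide g e) : 0 < edgeLen g := by
  obtain ⟨a, s, t, h, rfl, rfl⟩ := h
  simpa using h.sqLen_left_pos

lemma one_lt_edgeLen (h : IsFareySide g e) : 1 < edgeLen e := by
  have := h.edgeLen_lt; have := h.edgeLen_pos; omega

lemma toNat_edgeLen_lt (h : IsFareySide g e) : (edgeLen g).toNat < (edgeLen e).toNat := by
  have := h.edgeLen_lt; have := h.edgeLen_pos; omega

lemma isEdge (h : IsFareySide g e) : IsEdge g := by
  obtain ⟨a, s, t, h, rfl, rfl⟩ := h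
  exact isEdge_of_sub_eq h.1 (isCoprime_one_left (x := 0)) (by simp)

lemma isAncestor (h : IsFareySide g e) : IsAncestor g e := Relation.ReflTransGen.single h

end IsFareySide

namespace IsAncestor

variable {g e f : Edge}

lemma of_eq (h : g = e) : IsAncestor g e := h ▸ .refl

lemma trans (h : IsAncestor g e) (h' : IsAncestor e f) : IsAncestor g f :=
  Relation.ReflTransGen.trans h h'

lemma edgeLen_le (h : IsAncestor g e) : edgeLen g ≤ edgeLen e := by
  induction h with
  | refl => rfl
  | tail _ h ih => exact ih.trans h.edgeLen_lt.le

lemma eq_or_exists_isFareySide (h : IsAncestor g e) :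
    g = e ∨ ∃ k, IsAncestor g k ∧ IsFareySide k e :=
  (Relation.ReflTransGen.cases_tail h).imp Eq.symm id

lemma eq_of_edgeLen_le (h : IsAncestor g e) (hle : edgeLen e ≤ edgeLen g) : g = e := by
  rcases h.eq_or_exists_isFareySide with h | ⟨k, hk, hs⟩
  · exact h
  · have := hk.edgeLen_le; have := hs.edgeLen_lt; omega

lemma antisymm (h : IsAncestor g e) (h' : IsAncestor e g) : g = e :=
  h.eq_of_edgeLen_le h'.edgeLen_le

lemma isEdge (h : IsAncestor g e) (he : IsEdge e) : IsEdge g := by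
  rcases Relation.ReflTransGen.cases_head h with rfl | ⟨k, hk, _⟩
  · exact he
  · exact hk.isEdge

end IsAncestor

/-! ### Crossing edges -/

/-- The two edges cross: the end points of each lie strictly on different sides of the other. -/
def Crosses (e e' : Edge) : Prop :=
  ∃ a b c d : Pt, e = s(a, b) ∧ e' = s(c, d) ∧
    orient a b c * orient a b d < 0 ∧ orient c d a * orient c d b < 0

lemma orient_swap (a b c : Pt) : orient b a c = -orient a b c := by
  simp only [orient]; ring

lemma crosses_mk {a b c d : Pt} : Crosses s(a, b) s(c, d) ↔
    orient a b c * orient a b d < 0 ∧ orient c d a * orient c d b < 0 := by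
  refine ⟨?_, fun ⟨h, h'⟩ => ⟨a, b, c, d, rfl, rfl, h, h'⟩⟩
  rintro ⟨a', b', c', d', hab, hcd, h, h'⟩
  rw [Sym2.eq_iff] at hab hcd
  rcases hab with ⟨rfl, rfl⟩ | ⟨rfl, rfl⟩ <;> rcases hcd with ⟨rfl, rfl⟩ | ⟨rfl, rfl⟩
  · exact ⟨h, h'⟩
  · rw [orient_swap d c, orient_swap d c]; constructor <;> linarith
  · rw [orient_swap b a, orient_swap b a]; constructor <;> linarith
  · rw [orient_swap b a, orient_swap b a, orient_swap d c, orient_swap d c]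
    constructor <;> linarith

lemma Crosses.symm {e e' : Edge} (h : Crosses e e') : Crosses e' e := by
  obtain ⟨a, b, c, d, he, he', h, h'⟩ := h
  exact ⟨c, d, a, b, he', he, h', h⟩

lemma not_crosses_self (e : Edge) : ¬ Crosses e e := by
  induction e using Sym2.ind with
  | _ a b => rw [crosses_mk]; simp [orient]

lemma not_crosses_of_left (a b c : Pt) : ¬ Crosses s(a, b) s(a, c) := by
  rw [crosses_mk]; simp [orient]

lemma not_crosses_of_right (a b c : Pt) : ¬ Crosses s(b, a) s(c, a) := by
  rw [Sym2.eq_swap, Sym2.eq_swap (a := c)]; exact not_crosses_of_left a b c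

lemma not_crosses_of_middle (a b c : Pt) : ¬ Crosses s(a, b) s(b, c) := by
  rw [Sym2.eq_swap]; exact not_crosses_of_left b a c

lemma not_crosses_translate (a s t : Pt) : ¬ Crosses s(a, a + s) s(a + t, a + t + s) := by
  have hparallel : orient a (a + s) (a + t + s) = orient a (a + s) (a + t) := by
    simp only [orient, Prod.fst_add, Prod.snd_add]; ring
  rw [crosses_mk, hparallel]
  exact fun h => h.1.not_ge (mul_self_nonneg _)

/-- The lattice point with coordinates `x`, `y` in the basis `s`, `t` at `o`. -/
def coordPt (o s t : Pt) (x y : ℤ) : Pt := o + (x • s + y • t)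

section CoordPt

variable (o s t : Pt)

lemma coordPt_zero_zero : coordPt o s t 0 0 = o := by simp [coordPt]

lemma coordPt_one_zero : coordPt o s t 1 0 = o + s := by simp [coordPt]

lemma coordPt_zero_one : coordPt o s t 0 1 = o + t := by simp [coordPt]

lemma coordPt_one_one : coordPt o s t 1 1 = o + (s + t) := by simp [coordPt]

lemma orient_coordPt (x₁ y₁ x₂ y₂ x₃ y₃ : ℤ) :
    orient (coordPt o s t x₁ y₁) (coordPt o s t x₂ y₂) (coordPt o s t x₃ y₃) =
      det s t * ((x₂ - x₁) * (y₃ - y₁) - (y₂ - y₁) * (x₃ - x₁)) := by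
  simp only [orient, coordPt, det, Prod.fst_add, Prod.snd_add, Prod.smul_fst, Prod.smul_snd,
    smul_eq_mul]
  ring

end CoordPt

lemma IsAcute.exists_coordPt {s t : Pt} (h : IsAcute s t) (o c : Pt) :
    ∃ x y, c = coordPt o s t x y := by
  obtain ⟨x, y, hxy⟩ := exists_coords_of_det_sq_eq_one h.1 (c - o)
  exact ⟨x, y, by rw [coordPt, ← hxy]; abel⟩

section CrossesCoordPt

variable {o s t : Pt} (h : det s t ^ 2 = 1)
include h

lemma crosses_coordPt {x₁ y₁ x₂ y₂ x₃ y₃ x₄ y₄ : ℤ} :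
    Crosses s(coordPt o s t x₁ y₁, coordPt o s t x₂ y₂)
      s(coordPt o s t x₃ y₃, coordPt o s t x₄ y₄) ↔
    ((x₂ - x₁) * (y₃ - y₁) - (y₂ - y₁) * (x₃ - x₁)) *
      ((x₂ - x₁) * (y₄ - y₁) - (y₂ - y₁) * (x₄ - x₁)) < 0 ∧
    ((x₄ - x₃) * (y₁ - y₃) - (y₄ - y₃) * (x₁ - x₃)) *
      ((x₄ - x₃) * (y₂ - y₃) - (y₄ - y₃) * (x₂ - x₃)) < 0 := by
  have hdet : ∀ A B : ℤ, det s t * A * (det s t * B) = A * B := fun A B => by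
    linear_combination (A * B) * h
  rw [crosses_mk]
  simp only [orient_coordPt, hdet]

lemma crosses_base_iff {x y p q : ℤ} :
    Crosses s(coordPt o s t x y, coordPt o s t (x + p) (y + q)) s(o, o + s) ↔
      (q * x - p * y) * (q * x - p * y - q) < 0 ∧ y * (y + q) < 0 := by
  have hiff := crosses_coordPt (o := o) h (x₁ := x) (y₁ := y) (x₂ := x + p) (y₂ := y + q)
    (x₃ := 0) (y₃ := 0) (x₄ := 1) (y₄ := 0)
  rw [coordPt_zero_zero, coordPt_one_zero] at hiff
  rw [hiff]
  ring_nf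

lemma crosses_diagonal_iff {x y p q : ℤ} :
    Crosses s(coordPt o s t x y, coordPt o s t (x + p) (y + q)) s(o, o + (s + t)) ↔
      (q * x - p * y) * (q * x - p * y + p - q) < 0 ∧ (y - x) * (y + q - (x + p)) < 0 := by
  have hiff := crosses_coordPt (o := o) h (x₁ := x) (y₁ := y) (x₂ := x + p) (y₂ := y + q)
    (x₃ := 0) (y₃ := 0) (x₄ := 1) (y₄ := 1)
  rw [coordPt_zero_zero, coordPt_one_one] at hiff
  rw [hiff]
  ring_nf

end CrossesCoordPt

/-- The segment from `(x, y)` to `(x + p, y + q)` passes upwards through the open unit segment of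
the first axis: it does so at the abscissa `x - p * y / q`. -/
def CrossesBase (x y p q : ℤ) : Prop :=
  y < 0 ∧ 0 < y + q ∧ 0 < q * x - p * y ∧ q * x - p * y < q

lemma crossesBase_of_crosses {o s t : Pt} (h : det s t ^ 2 = 1) {x y p q : ℤ} (hq : 0 < q)
    (hc : Crosses s(coordPt o s t x y, coordPt o s t (x + p) (y + q)) s(o, o + s)) :
    CrossesBase x y p q := by
  obtain ⟨hx, hy⟩ := (crosses_base_iff h).mp hc
  refine ⟨?_, ?_, ?_, ?_⟩ <;> (by_contra hcon; nlinarith)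

lemma CrossesBase.crosses_diagonal {o s t : Pt} (h : det s t ^ 2 = 1) {x y p q : ℤ}
    (hc : CrossesBase x y p q) (hlt : p + (q * x - p * y) < q) :
    Crosses s(coordPt o s t x y, coordPt o s t (x + p) (y + q)) s(o, o + (s + t)) := by
  obtain ⟨hy, hyq, hpos, -⟩ := hc
  have hx : y < x := by by_contra hcon; nlinarith
  have hx' : x + p < y + q := by by_contra hcon; nlinarith
  exact (crosses_diagonal_iff h).mpr
    ⟨mul_neg_of_pos_of_neg hpos (by linarith), mul_neg_of_neg_of_pos (by linarith) (by linarith)⟩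

/-! ### Edges that cross a side of a Farey parallelogram -/

/-- Every edge with coordinates `(p, q)` in the basis `s`, `t` that crosses a translate of `s`
upwards has the diagonal of the adjacent parallelogram on `s`, `t` as an ancestor. -/
def DiagonalIsAncestor (s t : Pt) (p q : ℤ) : Prop :=
  ∀ (o : Pt) (x y : ℤ), CrossesBase x y p q →
    IsAncestor s(o, o + (s + t)) s(coordPt o s t x y, coordPt o s t (x + p) (y + q))

lemma IsAcute.isAncestor_diagonal_of_lower {s t o : Pt} (h : IsAcute s t) {e : Edge}
    (he : IsAncestor s(o - t, o + (s + t)) e) : IsAncestor s(o, o + (s + t)) e :=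
  (h.add_left.symm.isFareySide_right (by abel) (by abel)).isAncestor.trans he

namespace DiagonalIsAncestor

variable {s t : Pt} {p q : ℤ}

lemma below (H : DiagonalIsAncestor (-s) (-t) p q) (o : Pt) {x y : ℤ} (hc : CrossesBase x y p q) :
    IsAncestor s(o - t, o + s) s(coordPt o s t x y, coordPt o s t (x + p) (y + q)) := by
  obtain ⟨hy, hyq, hpos, hlt⟩ := hc
  have hanc := H (o + s) (1 - (x + p)) (-(y + q))
    ⟨by omega, by omega, by linarith, by linarith⟩
  convert hanc using 1
  · exact edge_congr_swap (by abel) rfl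
  · exact edge_congr_swap (by simp only [coordPt]; module) (by simp only [coordPt]; module)

lemma swap (H : DiagonalIsAncestor t s q p) (o : Pt) {x y : ℤ} (hc : CrossesBase y x q p) :
    IsAncestor s(o, o + (s + t)) s(coordPt o s t x y, coordPt o s t (x + p) (y + q)) := by
  convert H o y x hc using 1
  · rw [add_comm s]
  · exact edge_congr (by simp only [coordPt]; abel) (by simp only [coordPt]; abel)

lemma of_add_right (h : IsAcute s t) (H : DiagonalIsAncestor s (s + t) (p - q) q) :
    DiagonalIsAncestor s t p q := by
  rintro o x y ⟨hy, hyq, hpos, hlt⟩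
  have hanc := H o (x - y) y ⟨hy, hyq, by linarith, by linarith⟩
  have hside : IsFareySide s(o, o + (s + t)) s(o, o + (s + (s + t))) :=
    h.add_right.symm.isFareySide_left rfl (by abel)
  refine hside.isAncestor.trans ?_
  convert hanc using 1
  exact edge_congr (by simp only [coordPt]; module) (by simp only [coordPt]; module)

/-- The edge leaves the triangle above the base through the diagonal. -/
lemma isAncestor_of_apex_right (h : IsAcute s t) (hpq : p < q)
    (H : DiagonalIsAncestor (s + t) t p (q - p)) (o : Pt) {x y : ℤ} (hc : CrossesBase x y p q)
    (hapex : p + (q * x - p * y) < q) :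
    IsAncestor s(o, o + (s + t)) s(coordPt o s t x y, coordPt o s t (x + p) (y + q)) := by
  obtain ⟨hy, hyq, hpos, -⟩ := hc
  have hanc := H o x (y - x) ⟨by by_contra hcon; nlinarith, by by_contra hcon; nlinarith,
    by linarith, by linarith⟩
  refine (h.add_left.isFareySide_left rfl rfl).isAncestor.trans ?_
  convert hanc using 1
  exact edge_congr (by simp only [coordPt]; module) (by simp only [coordPt]; module)

/-- The edge leaves the triangle above the base through the other side. -/
lemma isAncestor_of_apex_left (h : IsAcute s t) (hp : 0 < p) (hpq : p < q)
    (H : DiagonalIsAncestor (-t) (-(s + t)) (q - p) p) (o : Pt) {x y : ℤ}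
    (hc : CrossesBase x y p q) (hapex : q < p + (q * x - p * y)) :
    IsAncestor s(o, o + (s + t)) s(coordPt o s t x y, coordPt o s t (x + p) (y + q)) := by
  obtain ⟨hy, hyq, -, hlt⟩ := hc
  have hanc := H.below (o + s) (x := y - (x - 1)) (y := x - 1)
    ⟨by by_contra hcon; nlinarith, by by_contra hcon; nlinarith, by linarith, by linarith⟩
  refine h.isAncestor_diagonal_of_lower ?_
  convert hanc using 1
  · exact edge_congr (by abel) (by abel)
  · exact edge_congr (by simp only [coordPt]; module) (by simp only [coordPt]; module)

/-- The edge ends at the apex of the triangle above the base, so it is determined by its direction;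
the three cases are the ways to leave the triangle below the base. -/
lemma isAncestor_of_apex_mem (h : IsAcute s t) (hp : 0 < p) (hpq : p < q) (hcop : IsCoprime p q)
    (H : DiagonalIsAncestor (s + t) t p (q - p)) (H' : DiagonalIsAncestor t (s + t) (q - p) p)
    (o : Pt) {x y : ℤ} (hc : CrossesBase x y p q) (hapex : p + (q * x - p * y) = q) :
    IsAncestor s(o, o + (s + t)) s(coordPt o s t x y, coordPt o s t (x + p) (y + q)) := by
  obtain ⟨hy, hyq, hpos, hlt⟩ := hc
  refine h.isAncestor_diagonal_of_lower ?_
  have hedge : s(coordPt o s t x y, coordPt o s t (x + p) (y + q)) =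
      s(coordPt (o - t) (s + t) t x (y + 1 - x),
        coordPt (o - t) (s + t) t (x + p) (y + 1 - x + (q - p))) :=
    edge_congr (by simp only [coordPt]; module) (by simp only [coordPt]; module)
  have hdiag : s(o - t, o + (s + t)) = s(o - t, o - t + (s + t + t)) :=
    edge_congr rfl (by abel)
  rw [hedge, hdiag]
  rcases lt_trichotomy q (2 * p) with hlt' | rfl | hlt'
  · exact H'.swap (o - t) ⟨by by_contra hcon; nlinarith, by by_contra hcon; nlinarith,
      by linarith, by linarith⟩
  · obtain rfl : p = 1 := by
      rcases Int.isUnit_iff.mp (hcop.isUnit_of_dvd' dvd_rfl (dvd_mul_left _ _)) with h | h <;> omega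
    obtain rfl : y = -1 := by omega
    obtain rfl : x = 0 := by omega
    exact .of_eq (edge_congr (by simp only [coordPt]; module) (by simp only [coordPt]; module))
  · exact H (o - t) x (y + 1 - x) ⟨by by_contra hcon; nlinarith, by by_contra hcon; nlinarith,
      by linarith, by linarith⟩

end DiagonalIsAncestor

/-- The subtractive Euclidean algorithm on `(p, q)`. -/
theorem IsAcute.diagonalIsAncestor {s t : Pt} (h : IsAcute s t) {p q : ℤ} (hp : 0 < p) (hq : 0 < q)
    (hcop : IsCoprime p q) : DiagonalIsAncestor s t p q := by
  induction hn : (p + q).toNat using Nat.strong_induction_on generalizing s t p q with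
  | _ n ih =>
  rcases lt_trichotomy q p with hlt | rfl | hlt
  · have hcop' : IsCoprime (p - q) q := by
      simpa [← sub_eq_add_neg] using hcop.add_mul_left_left (-1)
    exact .of_add_right h
      (ih (p - q + q).toNat (by omega) h.add_right (by omega) hq hcop' rfl)
  · rintro o x y ⟨-, -, hpos, hlt⟩
    have hlower : 0 < x - y := by nlinarith
    have hupper : x - y < 1 := by nlinarith
    omega
  · have hcop' : IsCoprime p (q - p) := by
      simpa [← sub_eq_add_neg] using hcop.add_mul_left_right (-1)
    have hn' : (p + (q - p)).toNat < n ∧ (q - p + p).toNat < n := by omega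
    have H := ih _ hn'.1 h.add_left hp (by omega) hcop' rfl
    have H' := ih _ hn'.2 h.add_left.symm (by omega) hp hcop'.symm rfl
    have H'' := ih _ hn'.2 h.add_left.symm.neg (by omega) hp hcop'.symm rfl
    intro o x y hc
    rcases lt_trichotomy (p + (q * x - p * y)) q with hapex | hapex | hapex
    · exact DiagonalIsAncestor.isAncestor_of_apex_right h hlt H o hc hapex
    · exact DiagonalIsAncestor.isAncestor_of_apex_mem h hp hlt hcop H H' o hc hapex
    · exact DiagonalIsAncestor.isAncestor_of_apex_left h hp hlt H'' o hc hapex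

lemma IsAcute.crosses_or_isAncestor_of_upward {s t : Pt} (h : IsAcute s t) {a : Pt} {x y p q : ℤ}
    (hq : 0 < q) (hcop : IsCoprime p q)
    (hc : Crosses s(coordPt a s t x y, coordPt a s t (x + p) (y + q)) s(a, a + s)) :
    Crosses s(coordPt a s t x y, coordPt a s t (x + p) (y + q)) s(a, a + (s + t)) ∨
      IsAncestor s(a, a + (s + t)) s(coordPt a s t x y, coordPt a s t (x + p) (y + q)) := by
  have hbase := crossesBase_of_crosses h.1 hq hc
  rcases lt_or_ge (p + (q * x - p * y)) q with hapex | hapex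
  · exact Or.inl (hbase.crosses_diagonal h.1 hapex)
  · have hp : 0 < p := by have := hbase.2.2.2; omega
    exact Or.inr (h.diagonalIsAncestor hp hq hcop a x y hbase)

theorem IsFareySide.crosses_or_isAncestor {g e g' : Edge} (h : IsFareySide g e) (hg' : IsEdge g')
    (hc : Crosses g' g) : Crosses g' e ∨ IsAncestor e g' := by
  obtain ⟨a, s, t, h, rfl, rfl⟩ := h
  obtain ⟨c, d, rfl, hcop⟩ := hg'
  obtain ⟨x, y, rfl⟩ := h.exists_coordPt a c
  obtain ⟨x', y', rfl⟩ := h.exists_coordPt a d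
  obtain ⟨p, rfl⟩ : ∃ p, x' = x + p := ⟨x' - x, by ring⟩
  obtain ⟨q, rfl⟩ : ∃ q, y' = y + q := ⟨y' - y, by ring⟩
  have hcop' : IsCoprime p q := by
    refine isCoprime_coords (s := s) (t := t) ?_
    convert hcop using 1 <;>
      simp only [coordPt, Prod.fst_add, Prod.snd_add, Prod.smul_fst, Prod.smul_snd, smul_eq_mul] <;>
      ring
  rcases lt_trichotomy q 0 with hq | rfl | hq
  · have hreverse := h.crosses_or_isAncestor_of_upward (a := a) (x := x + p) (y := y + q) (p := -p)
      (q := -q) (by omega) hcop'.neg_neg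
    rw [add_neg_cancel_right, add_neg_cancel_right, Sym2.eq_swap] at hreverse
    exact hreverse hc
  · have := ((crosses_base_iff h.1).mp hc).2
    nlinarith [mul_self_nonneg y]
  · exact h.crosses_or_isAncestor_of_upward hq hcop' hc

namespace IsFareySide

variable {g g' e : Edge}

lemma not_crosses (h : IsFareySide g e) : ¬ Crosses e g := by
  obtain ⟨a, s, t, -, rfl, rfl⟩ := h
  exact not_crosses_of_left _ _ _

lemma not_crosses_isFareySide (h : IsFareySide g e) (h' : IsFareySide g' e) : ¬ Crosses g g' := by
  obtain ⟨a, s, t, h, rfl, rfl⟩ := h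
  rcases (h.isFareySide_iff g').mp h' with rfl | rfl | rfl | rfl
  · exact not_crosses_self _
  · exact not_crosses_of_left _ _ _
  · exact not_crosses_of_middle _ _ _
  · exact not_crosses_translate a s t

end IsFareySide

namespace IsAncestor

variable {g g' e e' : Edge}

lemma crosses_or_isAncestor (h : IsAncestor g e) (hg' : IsEdge g') (hc : Crosses g' g) :
    Crosses g' e ∨ IsAncestor g g' := by
  induction h with
  | refl => exact Or.inl hc
  | tail h hs ih =>
    rcases ih with hcross | hanc
    · exact (hs.crosses_or_isAncestor hg' hcross).imp_right (h.tail hs).trans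
    · exact Or.inr hanc

lemma isAncestor_or_of_crosses (h : IsAncestor g e) (h' : IsAncestor g' e') (he : IsEdge e)
    (he' : IsEdge e') (hn : ¬ Crosses e e') (hc : Crosses g g') :
    IsAncestor g g' ∨ IsAncestor g' e := by
  rcases h.crosses_or_isAncestor (h'.isEdge he') hc.symm with hcross | hanc
  · exact Or.inr ((h'.crosses_or_isAncestor he hcross.symm).resolve_left hn)
  · exact Or.inl hanc

lemma comparable_of_common (h : IsAncestor g e) (h' : IsAncestor g' e) (hc : Crosses g g') :
    IsAncestor g g' ∨ IsAncestor g' g := by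
  induction hn : (edgeLen e).toNat using Nat.strong_induction_on generalizing e with
  | _ n ih =>
  rcases h.eq_or_exists_isFareySide with rfl | ⟨k, hk, hs⟩
  · exact Or.inr h'
  rcases h'.eq_or_exists_isFareySide with rfl | ⟨k', hk', hs'⟩
  · exact Or.inl h
  rcases hk.isAncestor_or_of_crosses hk' hs.isEdge hs'.isEdge (hs.not_crosses_isFareySide hs') hc
    with hanc | hanc
  · exact Or.inl hanc
  · exact ih _ (hn ▸ hs.toNat_edgeLen_lt) hk hanc rfl

theorem comparable (h : IsAncestor g e) (h' : IsAncestor g' e') (he : IsEdge e) (he' : IsEdge e')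
    (hn : ¬ Crosses e e') (hc : Crosses g g') : IsAncestor g g' ∨ IsAncestor g' g := by
  rcases h.isAncestor_or_of_crosses h' he he' hn hc with hanc | hanc
  · exact Or.inl hanc
  · exact h.comparable_of_common hanc hc

end IsAncestor

/-! ### Farey flips -/

/-- The flip inserts the long diagonal of a Farey parallelogram and removes the short one. -/
def IsFareyFlip (f : Flip) : Prop :=
  ∃ a s t : Pt, IsAcute s t ∧ f = ⟨s(a + s, a + t), s(a, a + (s + t))⟩

namespace IsFareyFlip

variable {f f' : Flip}

lemma ext_new (hf : IsFareyFlip f) (hf' : IsFareyFlip f') (h : f.new = f'.new) : f = f' := by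
  obtain ⟨a, s, t, ha, rfl⟩ := hf
  obtain ⟨a', s', t', ha', rfl⟩ := hf'
  ext1
  · rcases ha.parallelogram_unique ha' h.symm with ⟨rfl, rfl, rfl⟩ | ⟨rfl, rfl, rfl⟩ |
      ⟨rfl, rfl, rfl⟩ | ⟨rfl, rfl, rfl⟩
    · rfl
    · exact Sym2.eq_swap
    · exact edge_congr_swap (by abel) (by abel)
    · exact edge_congr (by abel) (by abel)
  · exact h

lemma crosses (hf : IsFareyFlip f) : Crosses f.new f.old := by
  obtain ⟨a, s, t, h, rfl⟩ := hf
  have hcross := (crosses_coordPt (o := a) h.1 (x₁ := 0) (y₁ := 0) (x₂ := 1) (y₂ := 1) (x₃ := 1)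
    (y₃ := 0) (x₄ := 0) (y₄ := 1)).mpr (by norm_num)
  rwa [coordPt_zero_zero, coordPt_one_zero, coordPt_zero_one, coordPt_one_one] at hcross

lemma isEdge_old (hf : IsFareyFlip f) : IsEdge f.old := by
  obtain ⟨a, s, t, h, rfl⟩ := hf
  exact isEdge_of_sub_eq h.1 (x := -1) (y := 1) isCoprime_one_right (by simp [sub_eq_neg_add])

lemma isEdge_new (hf : IsFareyFlip f) : IsEdge f.new := by
  obtain ⟨a, s, t, h, rfl⟩ := hf
  exact isEdge_of_sub_eq h.1 (x := 1) (y := 1) isCoprime_one_right (by simp)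

lemma edgeLen_old_lt (hf : IsFareyFlip f) : edgeLen f.old < edgeLen f.new := by
  obtain ⟨a, s, t, h, rfl⟩ := hf
  have hlt := h.sqLen_sub_lt_add
  rw [sqLen_sub_comm] at hlt
  simpa using hlt

lemma one_lt_edgeLen_new (hf : IsFareyFlip f) : 1 < edgeLen f.new := by
  obtain ⟨a, s, t, h, rfl⟩ := hf
  simpa using h.one_lt_sqLen_add

lemma not_crosses_old (hf : IsFareyFlip f) {k : Edge} (hk : IsFareySide k f.new) :
    ¬ Crosses f.old k := by
  obtain ⟨a, s, t, h, rfl⟩ := hf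
  rcases (h.isFareySide_iff k).mp hk with rfl | rfl | rfl | rfl
  · exact fun hc => not_crosses_of_middle _ _ _ hc.symm
  · exact not_crosses_of_right _ _ _
  · exact not_crosses_of_left _ _ _
  · rw [Sym2.eq_swap (a := a + s)]; exact not_crosses_of_left _ _ _

end IsFareyFlip

lemma IsAcute.isFareySide_diagonal {s t : Pt} (h : IsAcute s t) (hlt : sqLen t < sqLen s) (a : Pt) :
    IsFareySide s(a + s, a + t) s(a, a + s) := by
  rw [Sym2.eq_swap (a := a + s)]
  exact (h.sub_left hlt).symm.isFareySide_right rfl (by abel)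

namespace IsFareyFlip

variable {f : Flip}

lemma isAncestor_old_or_unit (hf : IsFareyFlip f) :
    IsAncestor f.old f.new ∨ ∃ a s t : Pt, IsAcute s t ∧ sqLen s = 1 ∧ sqLen t = 1 ∧
      f = ⟨s(a + s, a + t), s(a, a + (s + t))⟩ := by
  obtain ⟨a, s, t, h, rfl⟩ := hf
  rcases lt_trichotomy (sqLen t) (sqLen s) with hlt | heq | hlt
  · exact Or.inl ((h.isFareySide_diagonal hlt a).isAncestor.tail (h.isFareySide_left rfl rfl))
  · have hs := h.sqLen_eq_one heq.symm
    exact Or.inr ⟨a, s, t, h, hs, heq.trans hs, rfl⟩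
  · left
    have hdiag := h.symm.isFareySide_diagonal hlt a
    rw [Sym2.eq_swap] at hdiag
    exact hdiag.isAncestor.tail (h.symm.isFareySide_left rfl (by abel))

lemma edgeLen_old_eq_one_or_isAncestor (hf : IsFareyFlip f) :
    edgeLen f.old = 1 ∨ IsAncestor f.old f.new := by
  rcases hf.isAncestor_old_or_unit with hanc | ⟨a, s, t, h, hs, ht, rfl⟩
  · exact Or.inr hanc
  · left
    have hlen := h.sqLen_sub_eq_one hs ht
    rw [sqLen_sub_comm] at hlen
    simpa using hlen

end IsFareyFlip

lemma IsFareySide.edgeLen_eq_one_or_exists_isFareyFlip {g e : Edge} (h : IsFareySide g e) :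
    edgeLen g = 1 ∨ ∃ f, IsFareyFlip f ∧ f.new = g := by
  obtain ⟨a, s, t, h, rfl, rfl⟩ := h
  rcases h.sqLen_eq_one_or_exists_add with hs | ⟨s', t', h', rfl⟩
  · left; simpa using hs
  · exact Or.inr ⟨_, ⟨a, s', t', h', rfl⟩, rfl⟩

/-- `g` is one of the longer sides of the Farey parallelogram of `e`, which is not a rhombus. -/
def IsLongFareySide (g e : Edge) : Prop :=
  ∃ a s t : Pt, IsAcute s t ∧ sqLen t < sqLen s ∧ g = s(a, a + s) ∧ e = s(a, a + (s + t))

namespace IsLongFareySide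

variable {g e : Edge}

lemma isFareySide (h : IsLongFareySide g e) : IsFareySide g e := by
  obtain ⟨a, s, t, h, -, hg, he⟩ := h
  exact ⟨a, s, t, h, hg, he⟩

lemma one_lt_edgeLen (h : IsLongFareySide g e) : 1 < edgeLen g := by
  obtain ⟨a, s, t, h, hlt, rfl, -⟩ := h
  have := h.sqLen_right_pos
  simp only [edgeLen_mk, add_sub_cancel_left]
  omega

end IsLongFareySide

lemma IsFareySide.isAncestor_long_or_unit {g e : Edge} (h : IsFareySide g e) :
    (∃ k, IsLongFareySide k e ∧ IsAncestor g k) ∨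
      ∃ a s t : Pt, IsAcute s t ∧ sqLen s = 1 ∧ sqLen t = 1 ∧ g = s(a, a + s) ∧
        e = s(a, a + (s + t)) := by
  obtain ⟨a, s, t, h, rfl, rfl⟩ := h
  rcases lt_trichotomy (sqLen t) (sqLen s) with hlt | heq | hlt
  · exact Or.inl ⟨_, ⟨a, s, t, h, hlt, rfl, rfl⟩, .refl⟩
  · have hs := h.sqLen_eq_one heq.symm
    exact Or.inr ⟨a, s, t, h, hs, heq.trans hs, rfl, rfl⟩
  · refine Or.inl ⟨s(a, a + t), ⟨a, t, s, h.symm, hlt, rfl, by rw [add_comm t]⟩, ?_⟩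
    exact ((h.symm.sub_left hlt).symm.isFareySide_left rfl (by abel)).isAncestor

namespace IsAncestor

variable {g e : Edge}

lemma eq_or_exists_isLongFareySide (h : IsAncestor g e) (hg : edgeLen g ≠ 1) :
    g = e ∨ ∃ k, IsLongFareySide k e ∧ IsAncestor g k := by
  rcases h.eq_or_exists_isFareySide with h | ⟨k, hk, hs⟩
  · exact Or.inl h
  · rcases hs.isAncestor_long_or_unit with ⟨k', hk', h'⟩ | ⟨a, s, t, -, hlen, -, rfl, -⟩
    · exact Or.inr ⟨k', hk', hk.trans h'⟩
    · have hunit : edgeLen s(a, a + s) = 1 := by simpa using hlen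
      rcases Relation.ReflTransGen.cases_head hk with rfl | ⟨m, hm, hmk⟩
      · exact absurd hunit hg
      · have := hm.one_lt_edgeLen
        have := edgeLen_le hmk
        omega

/-- The unit edge that crosses a longer side of `e` also crosses `e`, since it is too short to have
`e` as an ancestor. -/
lemma exists_triangle (h : IsAncestor g e) (hg : edgeLen g = 1) (he : edgeLen e ≠ 1) :
    ∃ a s t : Pt, IsAcute s t ∧ sqLen s = 1 ∧ sqLen t = 1 ∧ g = s(a, a + s) ∧
      Crosses s(a + s, a + t) e := by
  induction hn : (edgeLen e).toNat using Nat.strong_induction_on generalizing e with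
  | _ n ih =>
  obtain rfl | ⟨k, hk, hs⟩ := h.eq_or_exists_isFareySide
  · exact absurd hg he
  rcases hs.isAncestor_long_or_unit with ⟨k', hk', hkk'⟩ | ⟨a, s, t, hst, hs1, ht1, rfl, rfl⟩
  · have hside := hk'.isFareySide
    obtain ⟨a, s, t, hst, hs, ht, rfl, hc⟩ :=
      ih _ (hn ▸ hside.toNat_edgeLen_lt) (hk.trans hkk') hk'.one_lt_edgeLen.ne' rfl
    refine ⟨a, s, t, hst, hs, ht, rfl, ?_⟩
    have hflip : IsFareyFlip ⟨s(a + s, a + t), s(a, a + (s + t))⟩ := ⟨a, s, t, hst, rfl⟩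
    refine (hside.crosses_or_isAncestor hflip.isEdge_old hc).resolve_right fun hanc => ?_
    have hle := hanc.edgeLen_le
    have := hside.one_lt_edgeLen
    rw [edgeLen_mk, add_sub_add_left_eq_sub, sqLen_sub_comm, hst.sqLen_sub_eq_one hs ht] at hle
    omega
  · obtain rfl := hk.eq_of_edgeLen_le (by simp [hg, hs1])
    exact ⟨a, s, t, hst, hs1, ht1, rfl, (IsFareyFlip.crosses ⟨a, s, t, hst, rfl⟩).symm⟩

end IsAncestor

/-! ### Segments and triangles -/

lemma toR_add (p q : Pt) : toR (p + q) = toR p + toR q := by ext <;> simp [toR]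

lemma toR_sub (p q : Pt) : toR (p - q) = toR p - toR q := by ext <;> simp [toR]

lemma toR_zsmul (n : ℤ) (p : Pt) : toR (n • p) = (n : ℝ) • toR p := by ext <;> simp [toR]

lemma seg_mk (a b : Pt) : seg s(a, b) = segment ℝ (toR a) (toR b) := by
  have hpair : {p : Pt | p ∈ s(a, b)} = {a, b} := by ext p; simp
  rw [seg, hpair, Set.image_pair, convexHull_pair]

lemma add_smul_mem_seg (a b : Pt) {τ : ℝ} (h0 : 0 ≤ τ) (h1 : τ ≤ 1) :
    toR a + τ • toR (b - a) ∈ seg s(a, b) := by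
  rw [seg_mk, segment_eq_image', toR_sub]
  exact ⟨τ, ⟨h0, h1⟩, rfl⟩

lemma mem_convexHull_triangle_iff {E : Type*} [AddCommGroup E] [Module ℝ E] {a b c x : E} :
    x ∈ convexHull ℝ {a, b, c} ↔
      ∃ α β : ℝ, 0 ≤ α ∧ 0 ≤ β ∧ α + β ≤ 1 ∧ x = a + (α • (b - a) + β • (c - a)) := by
  constructor
  · rw [convexHull_insert (Set.insert_nonempty _ _), convexHull_pair, mem_convexJoin]
    rintro ⟨_, rfl, _, ⟨u, v, hu, hv, huv, rfl⟩, w, r, hw, hr, hwr, rfl⟩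
    obtain rfl : w = 1 - r := by linarith
    obtain rfl : u = 1 - v := by linarith
    refine ⟨r * (1 - v), r * v, by positivity, by positivity, by linarith, by module⟩
  · rintro ⟨α, β, hα, hβ, hαβ, rfl⟩
    have hmem := (convex_convexHull ℝ ({a, b, c} : Set E)).sum_mem (t := Finset.univ)
      (w := ![1 - α - β, α, β]) (z := ![a, b, c])
      (by intro i _; fin_cases i <;> simp [hα, hβ]; linarith)
      (by simp only [Fin.sum_univ_three, Matrix.cons_val]; ring)
      (by intro i _; fin_cases i <;> exact subset_convexHull ℝ _ (by simp))
    convert hmem using 1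
    simp only [Fin.sum_univ_three, Matrix.cons_val]
    module

lemma exists_real_coords {s t : Pt} (h : det s t ≠ 0) (w : Pt) :
    ∃ α β : ℝ, toR w = α • toR s + β • toR t := by
  have hdet : (det s t : ℝ) ≠ 0 := by exact_mod_cast h
  refine ⟨det w t / det s t, det s w / det s t, ?_⟩
  ext <;> simp only [toR, Prod.fst_add, Prod.snd_add, Prod.smul_fst, Prod.smul_snd, smul_eq_mul]
  all_goals field_simp; simp only [det]; push_cast; ring

lemma orient_eq_det (a b c : Pt) : orient a b c = det (b - a) (c - a) := rfl

lemma det_sq_eq_one_of_exists_coords {s t : Pt} (h : ∀ w : Pt, ∃ x y : ℤ, w = x • s + y • t) :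
    det s t ^ 2 = 1 := by
  obtain ⟨x, y, h₁⟩ := h (1, 0)
  obtain ⟨x', y', h₂⟩ := h (0, 1)
  have hunit : det s t * (x * y' - y * x') = 1 := by
    calc det s t * (x * y' - y * x') = det (x • s + y • t) (x' • s + y' • t) := by
          simp only [det, Prod.fst_add, Prod.snd_add, Prod.smul_fst, Prod.smul_snd, smul_eq_mul]
          ring
      _ = 1 := by rw [← h₁, ← h₂]; rfl
  exact Int.isUnit_sq (.of_mul_eq_one _ hunit)

namespace IsFacet

variable {T : Set Edge} {a b c : Pt}

lemma eq_of_toR_eq (h : IsFacet T a b c) {z : Pt} {α β : ℝ} (hα : 0 ≤ α) (hβ : 0 ≤ β)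
    (hαβ : α + β ≤ 1) (hz : toR z = α • toR (b - a) + β • toR (c - a)) :
    z = 0 ∨ z = b - a ∨ z = c - a := by
  have hmem : toR (a + z) ∈ convexHull ℝ {toR a, toR b, toR c} :=
    mem_convexHull_triangle_iff.mpr ⟨α, β, hα, hβ, hαβ, by rw [toR_add, hz, toR_sub, toR_sub]⟩
  refine (h.2.2.2.2 _ hmem).imp ?_ (.imp ?_ ?_) <;> intro h
  · simpa using h
  · exact eq_sub_of_add_eq' h
  · exact eq_sub_of_add_eq' h

/-- Reduce the coordinates of `w` to their fractional parts: the reduced point or its reflection in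
the centre of the parallelogram lies in the facet. -/
lemma exists_coords (h : IsFacet T a b c) (w : Pt) : ∃ x y : ℤ, w = x • (b - a) + y • (c - a) := by
  obtain ⟨α, β, hw⟩ := exists_real_coords (orient_eq_det a b c ▸ h.1) w
  set z := w - (⌊α⌋ • (b - a) + ⌊β⌋ • (c - a)) with hzw
  have hz : toR z = Int.fract α • toR (b - a) + Int.fract β • toR (c - a) := by
    rw [hzw, toR_sub, toR_add, toR_zsmul, toR_zsmul, hw, Int.fract, Int.fract]
    module
  obtain ⟨x, y, hxy⟩ : ∃ x y : ℤ, z = x • (b - a) + y • (c - a) := by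
    rcases le_total (Int.fract α + Int.fract β) 1 with hle | hge
    · rcases h.eq_of_toR_eq (Int.fract_nonneg α) (Int.fract_nonneg β) hle hz with h | h | h
      · exact ⟨0, 0, by simp [h]⟩
      · exact ⟨1, 0, by simp [h]⟩
      · exact ⟨0, 1, by simp [h]⟩
    · have hreflect : toR (b - a + (c - a) - z) =
          (1 - Int.fract α) • toR (b - a) + (1 - Int.fract β) • toR (c - a) := by
        rw [toR_sub, toR_add, hz]
        module
      rcases h.eq_of_toR_eq (sub_nonneg.mpr (Int.fract_lt_one α).le)
        (sub_nonneg.mpr (Int.fract_lt_one β).le) (by linarith) hreflect with h | h | h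
      · exact ⟨1, 1, by rw [one_smul, one_smul, sub_eq_zero.mp h]⟩
      · exact ⟨0, 1, by rw [zero_smul, one_smul, zero_add]; exact (add_left_cancel
          (sub_eq_iff_eq_add.mp h)).symm⟩
      · exact ⟨1, 0, by rw [zero_smul, one_smul, add_zero]; exact (add_left_cancel
          ((add_comm _ _).trans (sub_eq_iff_eq_add.mp h))).symm⟩
  exact ⟨x + ⌊α⌋, y + ⌊β⌋, by rw [← sub_add_cancel w, ← hzw, hxy]; module⟩

lemma orient_sq (h : IsFacet T a b c) : orient a b c ^ 2 = 1 := by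
  rw [orient_eq_det]
  exact det_sq_eq_one_of_exists_coords h.exists_coords

end IsFacet

/-! ### Crossing edges intersect -/

lemma sub_ne_zero_of_mul_neg {x y : ℝ} (h : x * y < 0) : x - y ≠ 0 :=
  sub_ne_zero.mpr fun hxy => h.not_ge (hxy ▸ mul_self_nonneg x)

lemma div_sub_pos {x y : ℝ} (h : x * y < 0) : 0 < x / (x - y) := by
  have hne := sub_ne_zero_of_mul_neg h
  have hmul : 0 < x * (x - y) := by nlinarith [mul_self_nonneg x]
  rw [← mul_div_mul_right x (x - y) hne]
  exact div_pos hmul (mul_self_pos.mpr hne)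

lemma div_sub_lt_one {x y : ℝ} (h : x * y < 0) : x / (x - y) < 1 := by
  have hpos := div_sub_pos (mul_comm x y ▸ h)
  have hne := sub_ne_zero_of_mul_neg h
  have hsum : x / (x - y) = 1 - y / (y - x) := by
    rw [← neg_sub x y, div_neg]
    field_simp
    ring
  linarith

lemma Crosses.exists_intersection {a b c d : Pt} (h : Crosses s(a, b) s(c, d)) :
    ∃ τ σ : ℝ, (0 < τ ∧ τ < 1) ∧ (0 < σ ∧ σ < 1) ∧
      toR a + τ • toR (b - a) = toR c + σ • toR (d - c) := by
  obtain ⟨hcd, hab⟩ := crosses_mk.mp h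
  have hcd' : (orient a b c : ℝ) * orient a b d < 0 := by exact_mod_cast hcd
  have hab' : (orient c d a : ℝ) * orient c d b < 0 := by exact_mod_cast hab
  refine ⟨_, _, ⟨div_sub_pos hab', div_sub_lt_one hab'⟩,
    ⟨div_sub_pos hcd', div_sub_lt_one hcd'⟩, ?_⟩
  have hne := sub_ne_zero_of_mul_neg hcd'
  have hneg : (orient c d a : ℝ) - orient c d b = -(orient a b c - orient a b d) := by
    simp only [orient]; push_cast; ring
  rw [hneg]
  ext <;> simp only [toR, Prod.fst_add, Prod.snd_add, Prod.smul_fst, Prod.smul_snd, Prod.fst_sub,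
    Prod.snd_sub, smul_eq_mul]
  all_goals field_simp; simp only [orient]; push_cast; ring

lemma NonCrossing.not_crosses {e e' : Edge} (h : NonCrossing e e') (he : IsEdge e) :
    ¬ Crosses e e' := by
  obtain ⟨a, b, rfl, m, n, hmn⟩ := he
  induction e' using Sym2.ind with
  | _ c d =>
  intro hc
  obtain ⟨τ, σ, ⟨hτ0, hτ1⟩, ⟨hσ0, hσ1⟩, hx⟩ := hc.exists_intersection
  obtain ⟨p, hp⟩ := h _
    ⟨add_smul_mem_seg a b hτ0.le hτ1.le, hx ▸ add_smul_mem_seg c d hσ0.le hσ1.le⟩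
  have hpa : toR (p - a) = τ • toR (b - a) := by rw [toR_sub, hp, add_sub_cancel_left]
  have hτ : ((m * (p - a).1 + n * (p - a).2 : ℤ) : ℝ) = τ := by
    have hfst : ((p - a).1 : ℝ) = τ * (b - a).1 := congrArg Prod.fst hpa
    have hsnd : ((p - a).2 : ℝ) = τ * (b - a).2 := congrArg Prod.snd hpa
    have hmn' : (m : ℝ) * (b - a).1 + n * (b - a).2 = 1 := by exact_mod_cast hmn
    rw [Int.cast_add, Int.cast_mul, Int.cast_mul, hfst, hsnd]
    linear_combination τ * hmn'
  rw [← hτ] at hτ0 hτ1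
  norm_cast at hτ0 hτ1
  omega

/-! ### Equilateral triangulations -/

lemma IsFacet.mk_mem {T : Set Edge} {a b c p q : Pt} (h : IsFacet T a b c)
    (hp : p ∈ ({a, b, c} : Set Pt)) (hq : q ∈ ({a, b, c} : Set Pt)) (hne : p ≠ q) :
    s(p, q) ∈ T := by
  obtain ⟨-, hab, hbc, hca, -⟩ := h
  rcases hp with rfl | rfl | rfl <;> rcases hq with rfl | rfl | rfl
  all_goals first
    | exact absurd rfl hne
    | assumption
    | (rw [Sym2.eq_swap]; assumption)

lemma abs_le_one_of_sqLen_le_one {x y : ℤ} (h : sqLen (x, y) ≤ 1) :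
    |x| ≤ 1 ∧ |y| ≤ 1 ∧ |x + y| ≤ 1 := by
  simp only [sqLen] at h
  refine ⟨?_, ?_, ?_⟩ <;> rw [← sq_le_one_iff_abs_le_one]
  · nlinarith [sq_nonneg (x + 2 * y)]
  · nlinarith [sq_nonneg (2 * x + y)]
  · nlinarith [sq_nonneg (x - y)]

lemma mem_Icc_of_weighted_mem_Icc {m n k : ℤ} (hn : |n - m| ≤ 1) (hk : |k - m| ≤ 1)
    {w u v : ℝ} (hw : 0 < w) (hu : 0 ≤ u) (hv : 0 ≤ v) (hsum : w + u + v = 1)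
    (h : w * m + u * n + v * k ∈ Set.Icc (0 : ℝ) 1) : 0 ≤ m ∧ m ≤ 1 := by
  obtain ⟨h0, h1⟩ := h
  rw [abs_le] at hn hk
  constructor <;> by_contra! hcon
  · have hm' : (m : ℝ) ≤ -1 := by exact_mod_cast (by omega : m ≤ -1)
    have hn' : (n : ℝ) ≤ 0 := by exact_mod_cast (by omega : n ≤ 0)
    have hk' : (k : ℝ) ≤ 0 := by exact_mod_cast (by omega : k ≤ 0)
    nlinarith
  · have hm' : (2 : ℝ) ≤ m := by exact_mod_cast (by omega : 2 ≤ m)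
    have hn' : (1 : ℝ) ≤ n := by exact_mod_cast (by omega : 1 ≤ n)
    have hk' : (1 : ℝ) ≤ k := by exact_mod_cast (by omega : 1 ≤ k)
    nlinarith

lemma real_coords_unique {s t : Pt} (h : det s t ≠ 0) {α β α' β' : ℝ}
    (heq : α • toR s + β • toR t = α' • toR s + β' • toR t) : α = α' ∧ β = β' := by
  have hdet : (det s t : ℝ) ≠ 0 := by exact_mod_cast h
  have hfst := congrArg Prod.fst heq
  have hsnd := congrArg Prod.snd heq
  simp only [toR, Prod.fst_add, Prod.snd_add, Prod.smul_fst, Prod.smul_snd, smul_eq_mul]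
    at hfst hsnd
  constructor <;> refine mul_right_cancel₀ hdet ?_ <;> simp only [det] <;> push_cast
  · linear_combination t.2 * hfst - t.1 * hsnd
  · linear_combination s.1 * hsnd - s.2 * hfst

lemma toR_coordPt (o s t : Pt) (x y : ℤ) :
    toR (coordPt o s t x y) = toR o + ((x : ℝ) • toR s + (y : ℝ) • toR t) := by
  rw [coordPt, toR_add, toR_add, toR_zsmul, toR_zsmul]

namespace IsAcute

variable {s t : Pt}

lemma det_ne_zero (h : IsAcute s t) : det s t ≠ 0 := fun h0 => by
  have := h.1
  rw [h0] at this
  norm_num at this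

lemma sqLen_coordPt_sub (h : IsAcute s t) (hs : sqLen s = 1) (ht : sqLen t = 1) (o : Pt)
    (x y x' y' : ℤ) : sqLen (coordPt o s t x' y' - coordPt o s t x y) = sqLen (x' - x, y' - y) := by
  have hdot : dot s t = 1 := by
    have hsub := sqLen_sub s t
    rw [h.sqLen_sub_eq_one hs ht, hs, ht] at hsub
    omega
  have hform : sqLen (coordPt o s t x' y' - coordPt o s t x y) =
      (x' - x) ^ 2 * sqLen s + (x' - x) * (y' - y) * dot s t + (y' - y) ^ 2 * sqLen t := by
    simp only [sqLen, dot, coordPt, Prod.fst_sub, Prod.snd_sub, Prod.fst_add, Prod.snd_add,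
      Prod.smul_fst, Prod.smul_snd, smul_eq_mul]
    ring
  rw [hform, hs, ht, hdot, sqLen]
  ring

/-- Each of the three coordinates `x`, `y`, `x + y` changes by at most one along a unit edge, and
all of them lie between zero and one in the unit triangle. -/
lemma mem_of_weighted_mem_convexHull (h : IsAcute s t) (hs : sqLen s = 1) (ht : sqLen t = 1)
    {o p q r : Pt} (hq : sqLen (q - p) ≤ 1) (hr : sqLen (r - p) ≤ 1) {w u v : ℝ} (hw : 0 < w)
    (hu : 0 ≤ u) (hv : 0 ≤ v) (hsum : w + u + v = 1)
    (hx : w • toR p + u • toR q + v • toR r ∈ convexHull ℝ {toR o, toR (o + s), toR (o + t)}) :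
    p ∈ ({o, o + s, o + t} : Set Pt) := by
  obtain ⟨α, β, hα, hβ, hαβ, hx⟩ := mem_convexHull_triangle_iff.mp hx
  obtain ⟨x, y, rfl⟩ := h.exists_coordPt o p
  obtain ⟨x', y', rfl⟩ := h.exists_coordPt o q
  obtain ⟨x'', y'', rfl⟩ := h.exists_coordPt o r
  rw [h.sqLen_coordPt_sub hs ht] at hq hr
  obtain ⟨hqx, hqy, hqxy⟩ := abs_le_one_of_sqLen_le_one hq
  obtain ⟨hrx, hry, hrxy⟩ := abs_le_one_of_sqLen_le_one hr
  have hcoords : (w * x + u * x' + v * x'') • toR s + (w * y + u * y' + v * y'') • toR t =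
      α • toR s + β • toR t := by
    rw [toR_coordPt, toR_coordPt, toR_coordPt, toR_add, toR_add, add_sub_cancel_left,
      add_sub_cancel_left] at hx
    obtain rfl : w = 1 - u - v := by linarith
    rw [← add_right_inj (toR o), ← hx]
    module
  obtain ⟨rfl, rfl⟩ := real_coords_unique h.det_ne_zero hcoords
  obtain ⟨hx0, hx1⟩ := mem_Icc_of_weighted_mem_Icc hqx hrx hw hu hv hsum ⟨hα, by linarith⟩
  obtain ⟨hy0, hy1⟩ := mem_Icc_of_weighted_mem_Icc hqy hry hw hu hv hsum ⟨hβ, by linarith⟩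
  obtain ⟨-, hxy⟩ := mem_Icc_of_weighted_mem_Icc (m := x + y) (n := x' + y') (k := x'' + y'')
    (by rwa [add_sub_add_comm]) (by rwa [add_sub_add_comm]) hw hu hv hsum
    ⟨by push_cast; linarith, by push_cast; linarith⟩
  obtain ⟨rfl, rfl⟩ | ⟨rfl, rfl⟩ | ⟨rfl, rfl⟩ :
      x = 0 ∧ y = 0 ∨ x = 1 ∧ y = 0 ∨ x = 0 ∧ y = 1 := by omega
  · simp [coordPt_zero_zero]
  · simp [coordPt_one_zero]
  · simp [coordPt_zero_one]

open scoped Topology in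
lemma exists_mem_seg_interior (h : IsAcute s t) {a : Pt} {e : Edge}
    (hc : Crosses s(a + s, a + t) e) : ∃ u v : ℝ, 0 < u ∧ 0 < v ∧ u + v < 1 ∧
      toR a + (u • toR s + v • toR t) ∈ seg e := by
  induction e using Sym2.ind with
  | _ c d =>
  obtain ⟨σ, τ, ⟨hσ0, hσ1⟩, ⟨hτ0, hτ1⟩, hx⟩ := hc.exists_intersection
  obtain ⟨p, q, hpq⟩ := exists_coords_of_det_sq_eq_one h.1 (d - c)
  have hne : (p + q : ℝ) ≠ 0 := by
    intro h0
    norm_cast at h0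
    have hparallel : orient (a + s) (a + t) d = orient (a + s) (a + t) c := by
      obtain rfl : d = c + (p • s + q • t) := by rw [← hpq]; abel
      simp only [orient, Prod.fst_add, Prod.snd_add, Prod.smul_fst, Prod.smul_snd, smul_eq_mul]
      linear_combination (s.2 * t.1 - s.1 * t.2) * h0
    have hneg := (crosses_mk.mp hc).1
    rw [hparallel] at hneg
    exact hneg.not_ge (mul_self_nonneg _)
  have hpos : ∀ {A : ℝ} (B : ℝ), 0 < A → ∀ᶠ δ : ℝ in 𝓝[>] 0, 0 < A - δ * B := fun {A} B hA => by
    have hcont : ContinuousAt (fun δ : ℝ => A - δ * B) 0 := by fun_prop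
    exact nhdsWithin_le_nhds (hcont.eventually_const_lt (by simpa using hA))
  obtain ⟨δ, hδu, hδv, hδ0, hδ1, hδ : 0 < δ⟩ := ((hpos ((p + q) * p) (sub_pos.mpr hσ1)).and
    ((hpos ((p + q) * q) hσ0).and ((hpos (p + q) hτ0).and
      ((hpos (-(p + q)) (sub_pos.mpr hτ1)).and self_mem_nhdsWithin)))).exists
  refine ⟨1 - σ - δ * ((p + q) * p), σ - δ * ((p + q) * q), hδu, hδv, ?_, ?_⟩
  · have := mul_pos hδ (mul_self_pos.mpr hne)
    linarith
  · have hpoint : toR a + ((1 - σ - δ * ((p + q) * p)) • toR s + (σ - δ * ((p + q) * q)) • toR t) =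
        toR c + (τ - δ * (p + q)) • toR (d - c) := by
      rw [sub_smul τ, ← add_sub_assoc, ← hx, hpq]
      simp only [toR_add, toR_sub, toR_zsmul]
      module
    rw [hpoint]
    exact add_smul_mem_seg c d hδ0.le (by linarith)

end IsAcute

lemma IsTriangulation.exists_isFacet {Ω : LatticePolygon} {T : Set Edge}
    (h : IsTriangulation Ω T) : ∃ a b c, IsFacet T a b c := by
  have hvertex : toR (Ω.vertex 0) ∈ Ω.region := by
    refine h.subset_region _ (h.side_mem 0) ?_
    rw [LatticePolygon.side, seg_mk]
    exact left_mem_segment _ _ _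
  obtain ⟨a, b, c, hf, -⟩ := h.exists_facet _ hvertex
  exact ⟨a, b, c, hf⟩

namespace IsEquilateralTriangulation

variable {Ω : LatticePolygon} {T : Set Edge}

lemma isAcute_of_isFacet (h : IsEquilateralTriangulation Ω T) {a b c : Pt}
    (hf : IsFacet T a b c) : IsAcute (b - a) (c - a) ∧ sqLen (b - a) = 1 ∧ sqLen (c - a) = 1 := by
  have hdet : det (b - a) (c - a) ^ 2 = 1 := hf.orient_sq
  obtain ⟨-, hab, hbc, hca, -⟩ := hf
  have hac : sqLen (c - a) = sqLen (b - a) := by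
    rw [Sym2.eq_swap] at hca
    exact h.2 _ _ _ _ hca hab
  have hdot : dot (b - a) (c - a) = sqLen (b - a) := by
    have hsub := sqLen_sub (b - a) (c - a)
    rw [sub_sub_sub_cancel_right, sqLen_sub_comm, h.2 _ _ _ _ hbc hab, hac] at hsub
    omega
  have hlen : sqLen (b - a) = 1 := by
    have hgram := four_mul_sqLen_mul_sqLen (b - a) (c - a)
    rw [hdet, hdot, hac] at hgram
    nlinarith [sqLen_pos_of_det_sq_eq_one hdet]
  exact ⟨⟨hdet, by rw [hdot, hlen]; norm_num⟩, hlen, hac.trans hlen⟩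

lemma edgeLen_eq_one (h : IsEquilateralTriangulation Ω T) {e : Edge} (he : e ∈ T) :
    edgeLen e = 1 := by
  obtain ⟨a, b, c, hf⟩ := h.1.exists_isFacet
  induction e using Sym2.ind with
  | _ p q => rw [edgeLen_mk, h.2 _ _ _ _ he hf.2.1, (h.isAcute_of_isFacet hf).2.1]

lemma exists_isFacet_of_weighted (h : IsEquilateralTriangulation Ω T) {p q r : Pt}
    (hpq : sqLen (q - p) ≤ 1) (hpr : sqLen (r - p) ≤ 1) (hqr : sqLen (r - q) ≤ 1) {w u v : ℝ}
    (hw : 0 < w) (hu : 0 < u) (hv : 0 ≤ v) (hsum : w + u + v = 1)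
    (hx : w • toR p + u • toR q + v • toR r ∈ Ω.region) :
    ∃ a b c, IsFacet T a b c ∧ p ∈ ({a, b, c} : Set Pt) ∧ q ∈ ({a, b, c} : Set Pt) ∧
      (0 < v → r ∈ ({a, b, c} : Set Pt)) := by
  obtain ⟨a, b, c, hf, hm⟩ := h.1.exists_facet _ hx
  obtain ⟨hacute, hs, ht⟩ := h.isAcute_of_isFacet hf
  obtain ⟨s, rfl⟩ : ∃ s, b = a + s := ⟨b - a, by abel⟩
  obtain ⟨t, rfl⟩ : ∃ t, c = a + t := ⟨c - a, by abel⟩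
  simp only [add_sub_cancel_left] at hacute hs ht
  refine ⟨_, _, _, hf, ?_, ?_, fun hv' => ?_⟩
  · exact hacute.mem_of_weighted_mem_convexHull hs ht hpq hpr hw hu.le hv hsum hm
  · rw [sqLen_sub_comm] at hpq
    refine hacute.mem_of_weighted_mem_convexHull hs ht hpq hqr hu hw.le hv (by linarith) ?_
    rwa [add_comm (u • toR q)]
  · rw [sqLen_sub_comm] at hpr hqr
    refine hacute.mem_of_weighted_mem_convexHull hs ht hpr hqr hv' hw.le hu.le (by linarith) ?_
    rwa [add_assoc, add_comm (v • toR r)]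

/-- The points of an edge in the polygon that lie in the open unit triangle belong to facets, and
only the triangle itself can be such a facet. -/
lemma mem_of_crosses (h : IsEquilateralTriangulation Ω T) {e : Edge} (he : seg e ⊆ Ω.region)
    {a s t : Pt} (hst : IsAcute s t) (hs : sqLen s = 1) (ht : sqLen t = 1)
    (hc : Crosses s(a + s, a + t) e) : s(a, a + s) ∈ T ∧ s(a + s, a + t) ∈ T := by
  obtain ⟨u, v, hu, hv, huv, hx⟩ := hst.exists_mem_seg_interior hc
  have hpoint : toR a + (u • toR s + v • toR t) =
      (1 - u - v) • toR a + u • toR (a + s) + v • toR (a + t) := by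
    rw [toR_add, toR_add]
    module
  rw [hpoint] at hx
  have hts : sqLen (t - s) = 1 := by rw [sqLen_sub_comm, hst.sqLen_sub_eq_one hs ht]
  obtain ⟨_, _, _, hf, ha, has, hat⟩ := h.exists_isFacet_of_weighted (by simp [hs]) (by simp [ht])
    (by simp [hts]) (by linarith) hu hv.le (by ring) (he hx)
  refine ⟨hf.mk_mem ha has fun h0 => ?_, hf.mk_mem has (hat hv) fun h0 => ?_⟩
  · rw [left_eq_add.mp h0] at hs
    simp [sqLen] at hs
  · rw [add_left_cancel h0] at hts
    simp [sqLen] at hts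

lemma mem_of_edgeLen_eq_one (h : IsEquilateralTriangulation Ω T) {e : Edge}
    (he : seg e ⊆ Ω.region) (hunit : edgeLen e = 1) : e ∈ T := by
  induction e using Sym2.ind with
  | _ c d =>
  rw [edgeLen_mk] at hunit
  have hmid : (1 / 2 : ℝ) • toR c + (1 / 2 : ℝ) • toR d + (0 : ℝ) • toR d ∈ seg s(c, d) := by
    have := add_smul_mem_seg c d (τ := 1 / 2) (by norm_num) (by norm_num)
    rw [toR_sub] at this
    convert this using 1
    module
  obtain ⟨_, _, _, hf, hp, hq, -⟩ := h.exists_isFacet_of_weighted hunit.le hunit.le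
    (by simp [sqLen]) (by norm_num) (by norm_num) le_rfl (by norm_num) (he hmid)
  refine hf.mk_mem hp hq ?_
  rintro rfl
  simp [sqLen] at hunit

end IsEquilateralTriangulation

/-! ### Flip paths -/

lemma applyFlips_append (T : Set Edge) (l l' : List Flip) :
    applyFlips T (l ++ l') = applyFlips (applyFlips T l) l' := List.foldl_append

lemma isFlipPath_append {T : Set Edge} {l l' : List Flip} :
    IsFlipPath T (l ++ l') ↔ IsFlipPath T l ∧ IsFlipPath (applyFlips T l) l' := by
  induction l generalizing T with
  | nil => simp [IsFlipPath, applyFlips]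
  | cons f l ih => simp [IsFlipPath, applyFlips, ih, and_assoc]

lemma mem_applyFlips {T : Set Edge} {l : List Flip} {e : Edge}
    (hmem : e ∈ T ∨ ∃ f ∈ l, f.new = e) (hold : ∀ f ∈ l, f.old ≠ e) : e ∈ applyFlips T l := by
  induction l generalizing T with
  | nil => simpa [applyFlips] using hmem
  | cons f l ih =>
    have hf := hold f (by simp)
    refine ih (T := applyFlip T f) ?_ fun g hg => hold g (by simp [hg])
    rcases hmem with he | ⟨g, hg, rfl⟩
    · exact Or.inl (Or.inl ⟨he, hf.symm⟩)
    · rcases List.mem_cons.mp hg with rfl | hg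
      · exact Or.inl (Or.inr rfl)
      · exact Or.inr ⟨g, hg, rfl⟩

lemma eq_add_sub_of_orient_eq_one {a b c d : Pt} (habc : orient a b c = 1)
    (hacd : orient a c d = 1) (hbcd : orient b c d = 1) : d = a + c - b := by
  simp only [orient] at habc hacd hbcd
  ext <;> simp only [Prod.fst_sub, Prod.fst_add, Prod.snd_sub, Prod.snd_add]
  · linear_combination (c.1 - b.1) * (hacd - hbcd) - (b.1 - a.1) * (hbcd - habc) -
      (d.1 - a.1 - (c.1 - b.1)) * habc
  · linear_combination (c.2 - b.2) * (hacd - hbcd) - (b.2 - a.2) * (hbcd - habc) -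
      (d.2 - a.2 - (c.2 - b.2)) * habc

lemma CanFlip.old_mem {T : Set Edge} {f : Flip} (h : CanFlip T f) : f.old ∈ T := by
  obtain ⟨a, b, c, d, hold, -, -, -, -, -, ⟨-, -, -, hca, -⟩, -⟩ := h
  rw [hold, Sym2.eq_swap]
  exact hca

lemma CanFlip.exists_parallelogram {T : Set Edge} {f : Flip} (h : CanFlip T f) :
    ∃ a s t : Pt, det s t ^ 2 = 1 ∧ f.old = s(a + s, a + t) ∧ f.new = s(a, a + (s + t)) ∧
      s(a, a + s) ∈ T ∧ s(a, a + t) ∈ T ∧ s(a + s, a + s + t) ∈ T ∧ s(a + t, a + t + s) ∈ T := by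
  obtain ⟨a, b, c, d, hold, hnew, habc_pos, hbcd_pos, hcda_pos, hdab_pos, hf₁, hf₂⟩ := h
  have hcda : orient c d a = orient a c d := by simp only [orient]; ring
  have habc : orient a b c = 1 := by nlinarith [hf₁.orient_sq]
  have hacd : orient a c d = 1 := by nlinarith [hf₂.orient_sq]
  have hbcd : orient b c d = 1 := by
    have hsum : orient b c d + orient d a b = orient a b c + orient a c d := by
      simp only [orient]; ring
    omega
  obtain ⟨s, rfl⟩ : ∃ s, a = b + s := ⟨a - b, by abel⟩
  obtain ⟨t, rfl⟩ : ∃ t, c = b + t := ⟨c - b, by abel⟩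
  obtain rfl : d = b + (s + t) := by
    rw [eq_add_sub_of_orient_eq_one habc hacd hbcd]; abel
  obtain ⟨-, hab, hbc, -, -⟩ := hf₁
  obtain ⟨-, -, hcd, hda, -⟩ := hf₂
  have hdet : det s t ^ 2 = 1 := by
    have : orient (b + s) b (b + t) = -det s t := by simp [orient, det]; ring
    rw [← neg_sq, ← this, habc, one_pow]
  refine ⟨b, s, t, hdet, hold, hnew, ?_, hbc, ?_, ?_⟩
  · rw [Sym2.eq_swap]; exact hab
  · rw [Sym2.eq_swap, add_assoc]; exact hda
  · rw [add_assoc, add_comm t s]; exact hcd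

/-- The long diagonal of a unimodular parallelogram is the edge that a flip inserts, or the edge
that it removes; in the second case the inserted edge is an ancestor of the removed one. -/
lemma CanFlip.isFareyFlip_or {T : Set Edge} {f : Flip} (h : CanFlip T f) :
    (IsFareyFlip f ∧ ∀ k, IsFareySide k f.new → k ∈ T) ∨
      edgeLen f.new = 1 ∨ IsAncestor f.new f.old := by
  obtain ⟨a, s, t, hdet, hold, hnew, hs, ht, hs', ht'⟩ := h.exists_parallelogram
  rcases lt_trichotomy (dot s t) 0 with hdot | hdot | hdot
  · right
    have hacute : IsAcute (-s) t := by
      refine ⟨?_, ?_⟩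
      · rw [← hdet]; simp [det]; ring
      · have : dot (-s) t = -dot s t := by simp [dot]; ring
        omega
    have hreverse : IsFareyFlip ⟨f.new, f.old⟩ := by
      refine ⟨a + s, -s, t, hacute, ?_⟩
      rw [hold, hnew, Flip.mk.injEq]
      exact ⟨edge_congr (by abel) (by abel), edge_congr rfl (by abel)⟩
    exact hreverse.edgeLen_old_eq_one_or_isAncestor
  · have hgram := four_mul_sqLen_mul_sqLen s t
    rw [hdet, hdot] at hgram
    omega
  · left
    have hacute : IsAcute s t := ⟨hdet, hdot⟩
    refine ⟨⟨a, s, t, hacute, Flip.ext hold hnew⟩, fun k hk => ?_⟩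
    rw [hnew, hacute.isFareySide_iff] at hk
    rcases hk with rfl | rfl | rfl | rfl <;> assumption

/-- Consider the last flip of the path. If it inserts `e`, then either it is the Farey flip of `e`,
whose sides were generated earlier, or it removes an edge with ancestor `e`. -/
theorem IsFlipPath.mem_of_isAncestor {T : Set Edge} (hT : ∀ e ∈ T, edgeLen e = 1) {l : List Flip}
    (hl : IsFlipPath T l) {e : Edge} (he : e ∈ applyFlips T l) {f : Flip} (hf : IsFareyFlip f)
    (ha : IsAncestor f.new e) : f ∈ l := by
  induction l using List.reverseRecOn generalizing e with
  | nil =>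
    have hle := ha.edgeLen_le
    rw [hT e he] at hle
    exact absurd hf.one_lt_edgeLen_new hle.not_gt
  | append_singleton l g ih =>
    obtain ⟨hl, hg, -⟩ := isFlipPath_append.mp hl
    have mem_of_earlier {e : Edge} (he : e ∈ applyFlips T l) (ha : IsAncestor f.new e) :
        f ∈ l ++ [g] := List.mem_append_left _ (ih hl he ha)
    rw [applyFlips_append] at he
    obtain ⟨he, -⟩ | rfl : (e ∈ applyFlips T l ∧ _) ∨ e = g.new := he
    · exact mem_of_earlier he ha
    rcases hg.isFareyFlip_or with ⟨hfarey, hsides⟩ | hunit | hanc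
    · rcases ha.eq_or_exists_isFareySide with heq | ⟨k, hk, hside⟩
      · simp [hf.ext_new hfarey heq]
      · exact mem_of_earlier (hsides k hside) hk
    · exact absurd hf.one_lt_edgeLen_new (hunit ▸ ha.edgeLen_le).not_gt
    · exact mem_of_earlier hg.old_mem (ha.trans hanc)

lemma isFacet_of_orient_sq_eq_one {T : Set Edge} {a b c : Pt} (h : orient a b c ^ 2 = 1)
    (hab : s(a, b) ∈ T) (hbc : s(b, c) ∈ T) (hca : s(c, a) ∈ T) : IsFacet T a b c := by
  rw [orient_eq_det] at h
  have hne : det (b - a) (c - a) ≠ 0 := fun h0 => by simp [h0] at h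
  refine ⟨hne, hab, hbc, hca, fun p hp => ?_⟩
  obtain ⟨α, β, hα, hβ, hαβ, hx⟩ := mem_convexHull_triangle_iff.mp hp
  obtain ⟨x, y, hxy⟩ := exists_coords_of_det_sq_eq_one h (p - a)
  have hcoords : α • toR (b - a) + β • toR (c - a) =
      (x : ℝ) • toR (b - a) + (y : ℝ) • toR (c - a) := by
    rw [← toR_zsmul, ← toR_zsmul, ← toR_add, ← hxy, toR_sub, toR_sub, toR_sub, hx,
      add_sub_cancel_left]
  obtain ⟨rfl, rfl⟩ := real_coords_unique hne hcoords
  norm_cast at hα hβ hαβ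
  obtain rfl : p = a + (x • (b - a) + y • (c - a)) := by rw [← hxy]; abel
  obtain ⟨rfl, rfl⟩ | ⟨rfl, rfl⟩ | ⟨rfl, rfl⟩ :
      x = 0 ∧ y = 0 ∨ x = 1 ∧ y = 0 ∨ x = 0 ∧ y = 1 := by omega
  all_goals simp

lemma IsFareyFlip.exists_positive_basis {f : Flip} (hf : IsFareyFlip f) :
    ∃ a s t : Pt, IsAcute s t ∧ det s t = 1 ∧ f = ⟨s(a + s, a + t), s(a, a + (s + t))⟩ := by
  obtain ⟨a, s, t, h, rfl⟩ := hf
  rcases sq_eq_one_iff.mp h.1 with hdet | hdet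
  · exact ⟨a, s, t, h, hdet, rfl⟩
  · refine ⟨a, t, s, h.symm, ?_, ?_⟩
    · rw [← neg_eq_iff_eq_neg.mpr hdet]; simp only [det]; ring
    · rw [Sym2.eq_swap, add_comm s t]

lemma IsFareyFlip.canFlip {T : Set Edge} {f : Flip} (hf : IsFareyFlip f) (hold : f.old ∈ T)
    (hside : ∀ k, IsFareySide k f.new → k ∈ T) : CanFlip T f := by
  obtain ⟨a, s, t, h, hdet, rfl⟩ := hf.exists_positive_basis
  simp only [h.isFareySide_iff, forall_eq_or_imp, forall_eq] at hside
  obtain ⟨hs, ht, hs', ht'⟩ := hside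
  have orient_eq {p q r : Pt} (hpqr : orient p q r = det s t) : orient p q r = 1 :=
    hpqr.trans hdet
  have ho₁ : orient (a + s) (a + (s + t)) (a + t) = 1 := orient_eq (by simp [orient, det]; ring)
  have ho₂ : orient (a + (s + t)) (a + t) a = 1 := orient_eq (by simp [orient, det]; ring)
  have ho₃ : orient (a + t) a (a + s) = 1 := orient_eq (by simp [orient, det]; ring)
  have ho₄ : orient a (a + s) (a + (s + t)) = 1 := orient_eq (by simp [orient, det]; ring)
  have ho₅ : orient (a + s) (a + t) a = 1 := orient_eq (by simp [orient, det]; ring)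
  refine ⟨a + s, a + (s + t), a + t, a, rfl, Sym2.eq_swap, by omega, by omega, by omega, by omega,
    isFacet_of_orient_sq_eq_one (by rw [ho₁, one_pow]) ?_ ?_ ?_,
    isFacet_of_orient_sq_eq_one (by rw [ho₅, one_pow]) hold ?_ hs⟩
  · rwa [← add_assoc]
  · rwa [Sym2.eq_swap, add_comm s t, ← add_assoc]
  · rwa [Sym2.eq_swap]
  · rwa [Sym2.eq_swap]

/-! ### Linear orderings of flip posets -/

lemma exists_isLinearOrder_of_not_le {α : Type*} (r : α → α → Prop) [IsPartialOrder α r] {a b : α}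
    (hab : ¬ r a b) : ∃ s : α → α → Prop, IsLinearOrder α s ∧ r ≤ s ∧ s b a := by
  have : IsPartialOrder α fun x y => r x y ∨ r x b ∧ r a y :=
    { refl := fun x => Or.inl (refl x)
      trans := by
        rintro x y z (hxy | ⟨hxb, hay⟩) (hyz | ⟨hyb, haz⟩)
        · exact Or.inl (_root_.trans hxy hyz)
        · exact Or.inr ⟨_root_.trans hxy hyb, haz⟩
        · exact Or.inr ⟨hxb, _root_.trans hay hyz⟩
        · exact Or.inr ⟨hxb, haz⟩
      antisymm := by
        rintro x y (hxy | ⟨hxb, hay⟩) (hyx | ⟨hyb, hax⟩)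
        · exact antisymm hxy hyx
        · exact absurd (_root_.trans hax (_root_.trans hxy hyb)) hab
        · exact absurd (_root_.trans hay (_root_.trans hyx hxb)) hab
        · exact absurd (_root_.trans hay hyb) hab }
  obtain ⟨s, hs, hrs⟩ := extend_partialOrder fun x y => r x y ∨ r x b ∧ r a y
  exact ⟨s, hs, fun x y hxy => hrs x y (Or.inl hxy), hrs b a (Or.inr ⟨refl b, refl a⟩)⟩

namespace FlipPoset.IsPoset

open Relation

variable {π π' : FlipPoset}

lemma isPartialOrder (h : π.IsPoset) : IsPartialOrder Flip (ReflGen π.le) :=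
  have : IsTrans Flip π.le := ⟨h.trans⟩
  { antisymm := by
      rintro x y (_ | hxy) (_ | hyx)
      · rfl
      · rfl
      · rfl
      · exact h.antisymm x y hxy hyx }

lemma exists_isLinearOrdering_of_extends (h : π.IsPoset) {s : Flip → Flip → Prop}
    (hs : IsLinearOrder Flip s) (hle : ReflGen π.le ≤ s) :
    ∃ l, π.IsLinearOrdering l ∧ l.Pairwise s := by
  classical
  have hsort := h.finite.toFinset.pairwise_sort s
  have hnodup := h.finite.toFinset.sort_nodup s
  refine ⟨h.finite.toFinset.sort s, ⟨⟨hnodup, fun f => by simp⟩, ?_⟩, hsort⟩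
  refine (hsort.and hnodup).imp fun {f g} hfg hgf => ?_
  exact hfg.2 (_root_.antisymm (r := s) hfg.1 (hle g f (.single hgf)))

lemma exists_isLinearOrdering (h : π.IsPoset) : ∃ l, π.IsLinearOrdering l := by
  have := h.isPartialOrder
  obtain ⟨s, hs, hle⟩ := extend_partialOrder (ReflGen π.le)
  obtain ⟨l, hl, -⟩ := h.exists_isLinearOrdering_of_extends hs hle
  exact ⟨l, hl⟩

lemma exists_isLinearOrdering_of_not_le (h : π.IsPoset) {f g : Flip} (hf : f ∈ π.flips)
    (hg : g ∈ π.flips) (hfg : ¬ π.le f g) : ∃ l, π.IsLinearOrdering l ∧ [g, f].Sublist l := by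
  have := h.isPartialOrder
  have hne : g ≠ f := by
    rintro rfl
    exact hfg (h.refl g hg)
  obtain ⟨s, hs, hle, hgf⟩ := exists_isLinearOrder_of_not_le (ReflGen π.le) (a := f) (b := g)
    fun hfg' => hfg ((reflGen_iff _ _ _).mp hfg' |>.resolve_left hne)
  obtain ⟨l, hl, hsort⟩ := h.exists_isLinearOrdering_of_extends hs hle
  refine ⟨l, hl, List.sublist_of_subperm_of_pairwise (r := s) ?_ (by simpa using hgf) hsort⟩
  exact List.subperm_of_subset (by simpa using hne) (by simp [hl.1.2, hf, hg])

lemma le_of_forall_isLinearOrdering (h : π.IsPoset) (h' : π'.IsPoset) (hflips : π'.flips = π.flips)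
    (hl : ∀ l, π.IsLinearOrdering l → π'.IsLinearOrdering l) {f g : Flip} (hle : π'.le f g) :
    π.le f g := by
  by_contra hnle
  obtain ⟨hf, hg⟩ := h'.mem_of_le f g hle
  obtain ⟨l, hlin, hsub⟩ := h.exists_isLinearOrdering_of_not_le (hflips ▸ hf) (hflips ▸ hg) hnle
  exact (hl l hlin).2.forall_sublist hsub hle

lemma eq_of_isLinearOrdering_iff (h : π.IsPoset) (h' : π'.IsPoset) (hflips : π'.flips = π.flips)
    (hl : ∀ l, π'.IsLinearOrdering l ↔ π.IsLinearOrdering l) : π' = π := by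
  ext f g
  · rw [hflips]
  · exact ⟨h.le_of_forall_isLinearOrdering h' hflips fun l => (hl l).mpr,
      h'.le_of_forall_isLinearOrdering h hflips.symm fun l => (hl l).mp⟩

end FlipPoset.IsPoset

/-! ### The plan for a set of edges -/

/-- The Farey flips that insert an ancestor of an edge in `G`. -/
def flipsBelow (G : Set Edge) : Set Flip := {f | IsFareyFlip f ∧ ∃ e ∈ G, IsAncestor f.new e}

/-- The Farey flips that insert an ancestor of an edge in `G`, ordered by ancestry of the inserted
edges. For the edges in `E` this is the plan `π_E` (`multiFlipPlan_eq`). -/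
def planOf (G : Set Edge) : FlipPoset where
  flips := flipsBelow G
  le f g := f ∈ flipsBelow G ∧ g ∈ flipsBelow G ∧ IsAncestor f.new g.new

lemma setOf_isFareySide_finite (e : Edge) : {k | IsFareySide k e}.Finite := by
  by_cases hne : ∃ k, IsFareySide k e
  · obtain ⟨k, a, s, t, h, -, rfl⟩ := hne
    simp only [h.isFareySide_iff]
    exact Set.toFinite {s(a, a + s), s(a, a + t), s(a + s, a + s + t), s(a + t, a + t + s)}
  · push Not at hne
    simp [hne]

lemma setOf_isAncestor_finite (e : Edge) : {g | IsAncestor g e}.Finite := by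
  induction hn : (edgeLen e).toNat using Nat.strong_induction_on generalizing e with
  | _ n ih =>
  have hsub : {g | IsAncestor g e} ⊆
      {e} ∪ ⋃ k ∈ {k | IsFareySide k e}, {g | IsAncestor g k} := by
    intro g hg
    rcases IsAncestor.eq_or_exists_isFareySide hg with rfl | ⟨k, hk, hs⟩
    · simp
    · right
      simp only [Set.mem_iUnion]
      exact ⟨k, hs, hk⟩
  refine ((Set.finite_singleton e).union ?_).subset hsub
  exact (setOf_isFareySide_finite e).biUnion fun k hk => ih _ (hn ▸ hk.toNat_edgeLen_lt) k rfl

lemma flipsBelow_finite {G : Set Edge} (hG : G.Finite) : (flipsBelow G).Finite := by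
  have hedges : (⋃ e ∈ G, {g | IsAncestor g e}).Finite :=
    hG.biUnion fun e _ => setOf_isAncestor_finite e
  refine Set.Finite.of_finite_image (f := Flip.new) (hedges.subset ?_)
    fun f hf g hg h => hf.1.ext_new hg.1 h
  rintro _ ⟨f, ⟨-, e, he, h⟩, rfl⟩
  simp only [Set.mem_iUnion]
  exact ⟨e, he, h⟩

lemma mem_flipsBelow_of_isAncestor {G : Set Edge} {f g : Flip} (hg : g ∈ flipsBelow G)
    (hf : IsFareyFlip f) (h : IsAncestor f.new g.new) : f ∈ flipsBelow G := by
  obtain ⟨-, e, he, h'⟩ := hg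
  exact ⟨hf, e, he, h.trans h'⟩

lemma isPoset_planOf {G : Set Edge} (hG : G.Finite) : (planOf G).IsPoset where
  finite := flipsBelow_finite hG
  mem_of_le _ _ h := ⟨h.1, h.2.1⟩
  refl _ h := ⟨h, h, .refl⟩
  trans _ _ _ h h' := ⟨h.1, h'.2.1, h.2.2.trans h'.2.2⟩
  antisymm _ _ h h' := h.1.1.ext_new h.2.1.1 (h.2.2.antisymm h'.2.2)

/-! ### Farey flips that remove the same edge -/

namespace IsEdge

variable {a b c d : Pt}

lemma isCoprime (h : IsEdge s(a, b)) : IsCoprime (b.1 - a.1) (b.2 - a.2) := by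
  obtain ⟨a', b', he, hcop⟩ := h
  rcases Sym2.eq_iff.mp he with ⟨rfl, rfl⟩ | ⟨rfl, rfl⟩
  · exact hcop
  · simpa using hcop.neg_neg

lemma exists_sub_eq_zsmul (h : IsEdge s(a, b)) (hc : orient a b c = 0) :
    ∃ k : ℤ, c - a = k • (b - a) := by
  obtain ⟨m, n, hmn⟩ := h.isCoprime
  simp only [orient] at hc
  refine ⟨m * (c.1 - a.1) + n * (c.2 - a.2), ?_⟩
  ext <;> simp only [Prod.fst_sub, Prod.snd_sub, Prod.smul_fst, Prod.smul_snd, smul_eq_mul]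
  · linear_combination (-(c.1 - a.1)) * hmn + (-n) * hc
  · linear_combination (-(c.2 - a.2)) * hmn + m * hc

lemma isUnit_of_sub_eq_zsmul (h : IsEdge s(a, b)) {k : ℤ} {w : Pt} (hk : b - a = k • w) :
    IsUnit k := by
  refine h.isCoprime.isUnit_of_dvd' ⟨w.1, ?_⟩ ⟨w.2, ?_⟩
  · rw [← Prod.fst_sub, hk, Prod.smul_fst, smul_eq_mul]
  · rw [← Prod.snd_sub, hk, Prod.smul_snd, smul_eq_mul]

lemma orient_ne_zero_of_add_eq_add (hab : IsEdge s(a, b)) (hcd : IsEdge s(c, d))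
    (h : a + b = c + d) (hne : s(a, b) ≠ s(c, d)) : orient a b c ≠ 0 := by
  intro hzero
  obtain ⟨k, hk⟩ := hab.exists_sub_eq_zsmul hzero
  obtain rfl : c = a + k • (b - a) := by rw [← hk]; abel
  obtain rfl : d = b - k • (b - a) := by
    rw [eq_sub_iff_add_eq, ← add_left_cancel_iff (a := a), h]
    abel
  have hunit : IsUnit (1 - 2 * k) := hcd.isUnit_of_sub_eq_zsmul (w := b - a) (by module)
  rcases Int.isUnit_iff.mp hunit with hk' | hk'
  · obtain rfl : k = 0 := by omega
    exact hne (edge_congr (by module) (by module))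
  · obtain rfl : k = 1 := by omega
    exact hne (edge_congr_swap (by module) (by module))

/-- The hypothesis `h` says that the edges have the same midpoint. -/
lemma crosses_of_add_eq_add (hab : IsEdge s(a, b)) (hcd : IsEdge s(c, d)) (h : a + b = c + d)
    (hne : s(a, b) ≠ s(c, d)) : Crosses s(a, b) s(c, d) := by
  have hpos := mul_self_pos.mpr (hab.orient_ne_zero_of_add_eq_add hcd h hne)
  obtain rfl : d = a + b - c := by rw [h]; abel
  have habd : orient a b (a + b - c) = -orient a b c := by simp [orient]; ring
  have hcda : orient c (a + b - c) a = -orient a b c := by simp [orient]; ring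
  have hcdb : orient c (a + b - c) b = orient a b c := by simp [orient]; ring
  rw [crosses_mk, habd, hcda, hcdb]
  constructor <;> linarith

end IsEdge

namespace IsFareyFlip

variable {f g : Flip}

/-- The diagonals of a parallelogram have the same midpoint. -/
lemma crosses_of_old_eq (hf : IsFareyFlip f) (hg : IsFareyFlip g) (h : f.old = g.old)
    (hne : f ≠ g) : Crosses f.new g.new := by
  have hnew : f.new ≠ g.new := fun h => hne (hf.ext_new hg h)
  have hfe := hf.isEdge_new
  have hge := hg.isEdge_new
  obtain ⟨a, s, t, -, rfl⟩ := hf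
  obtain ⟨b, u, v, -, rfl⟩ := hg
  refine hfe.crosses_of_add_eq_add hge ?_ hnew
  calc a + (a + (s + t)) = (a + s) + (a + t) := by abel
    _ = (b + u) + (b + v) := by
      rcases Sym2.eq_iff.mp h with ⟨h₁, h₂⟩ | ⟨h₁, h₂⟩
      · rw [h₁, h₂]
      · rw [h₁, h₂, add_comm]
    _ = b + (b + (u + v)) := by abel

lemma not_isAncestor_new_old (hf : IsFareyFlip f) : ¬ IsAncestor f.new f.old :=
  fun h => h.edgeLen_le.not_gt hf.edgeLen_old_lt

lemma not_isAncestor_of_old_eq (hf : IsFareyFlip f) (hg : IsFareyFlip g) (h : f.old = g.old)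
    (hne : f ≠ g) : ¬ IsAncestor f.new g.new := by
  intro hanc
  rcases hanc.eq_or_exists_isFareySide with heq | ⟨k, hk, hs⟩
  · exact hne (hf.ext_new hg heq)
  · rcases hk.crosses_or_isAncestor hg.isEdge_old (h ▸ hf.crosses.symm) with hcross | hanc'
    · exact hg.not_crosses_old hs hcross
    · exact hf.not_isAncestor_new_old (h ▸ hanc')

end IsFareyFlip

/-! ### Validity and minimality of the plan -/

/-- The conditions on the unit triangulation `T` and the noncrossing edges `G` under which
`planOf G` is the plan that generates `G` from `T`. They say of the polygon only that `T` contains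
the unit edges that the plan needs. -/
structure Admissible (T G : Set Edge) : Prop where
  edgeLen_eq_one : ∀ e ∈ T, edgeLen e = 1
  finite : G.Finite
  isEdge : ∀ e ∈ G, IsEdge e
  not_crosses : ∀ e ∈ G, ∀ e' ∈ G, ¬ Crosses e e'
  mem_of_edgeLen_eq_one : ∀ e ∈ G, edgeLen e = 1 → e ∈ T
  exists_isFareyFlip : ∀ e ∈ G, edgeLen e ≠ 1 → ∃ f, IsFareyFlip f ∧ f.new = e
  mem_of_crosses : ∀ e ∈ G, ∀ a s t : Pt, IsAcute s t → sqLen s = 1 → sqLen t = 1 →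
    Crosses s(a + s, a + t) e → s(a, a + s) ∈ T ∧ s(a + s, a + t) ∈ T

lemma isFlipPath_of_forall_canFlip {T : Set Edge} {l : List Flip}
    (h : ∀ l₁ f l₂, l = l₁ ++ f :: l₂ → CanFlip (applyFlips T l₁) f) : IsFlipPath T l := by
  induction l using List.reverseRecOn with
  | nil => trivial
  | append_singleton l f ih =>
    refine isFlipPath_append.mpr ⟨ih fun l₁ g l₂ hl => ?_, h l f [] rfl, trivial⟩
    exact h l₁ g (l₂ ++ [f]) (by simp [hl])

lemma IsAncestor.edgeLen_eq_one_or_exists_isFareyFlip {g e : Edge} (h : IsAncestor g e)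
    (hne : g ≠ e) : edgeLen g = 1 ∨ ∃ f, IsFareyFlip f ∧ f.new = g := by
  rcases Relation.ReflTransGen.cases_head h with heq | ⟨k, hk, -⟩
  · exact absurd heq hne
  · exact hk.edgeLen_eq_one_or_exists_isFareyFlip

section LinearOrdering

variable {G : Set Edge} {l l' : List Flip} {g : Flip}
  (hl : (planOf G).IsLinearOrdering (l ++ g :: l'))
include hl

lemma not_isAncestor_of_mem_left {f : Flip} (hf : f ∈ l) : ¬ IsAncestor g.new f.new := by
  intro hanc
  have hpair := (List.pairwise_append.mp hl.2).2.2
  exact hpair f hf g (by simp) ⟨(hl.1.2 g).mp (by simp), (hl.1.2 f).mp (by simp [hf]), hanc⟩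

lemma exists_mem_left_of_isAncestor {k : Edge} (hk : IsAncestor k g.new) (hne : k ≠ g.new)
    (hlen : edgeLen k ≠ 1) : ∃ f ∈ l, f.new = k := by
  obtain ⟨f, hf, rfl⟩ := (hk.edgeLen_eq_one_or_exists_isFareyFlip hne).resolve_left hlen
  have hg : g ∈ flipsBelow G := (hl.1.2 g).mp (by simp)
  have hfG := mem_flipsBelow_of_isAncestor hg hf hk
  refine ⟨f, ?_, rfl⟩
  rcases List.mem_append.mp ((hl.1.2 f).mpr hfG) with hmem | hmem
  · exact hmem
  · rcases List.mem_cons.mp hmem with rfl | hmem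
    · exact absurd rfl hne
    · have hpair := (List.pairwise_append.mp hl.2).2.1
      exact absurd ⟨hfG, hg, hk⟩ ((List.pairwise_cons.mp hpair).1 f hmem)

end LinearOrdering

namespace Admissible

variable {T G : Set Edge} {f g : Flip} {l : List Flip}

lemma mem_of_isAncestor (h : Admissible T G) (hf : f ∈ flipsBelow G) {k : Edge}
    (hk : IsAncestor k f.new) (hlen : edgeLen k = 1) : k ∈ T := by
  obtain ⟨hfarey, e, he, hanc⟩ := hf
  have hne : edgeLen e ≠ 1 := (hfarey.one_lt_edgeLen_new.trans_le hanc.edgeLen_le).ne'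
  obtain ⟨a, s, t, hst, hs, ht, rfl, hc⟩ := (hk.trans hanc).exists_triangle hlen hne
  exact (h.mem_of_crosses e he a s t hst hs ht hc).1

lemma old_mem (h : Admissible T G) (hf : f ∈ flipsBelow G) (hlen : edgeLen f.old = 1) :
    f.old ∈ T := by
  rcases hf.1.isAncestor_old_or_unit with hanc | ⟨a, s, t, hst, hs, ht, hfeq⟩
  · exact h.mem_of_isAncestor hf hanc hlen
  · obtain ⟨hfarey, e, he, hanc⟩ := hf
    have hcross := (hanc.crosses_or_isAncestor hfarey.isEdge_old hfarey.crosses.symm).resolve_right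
      hfarey.not_isAncestor_new_old
    subst hfeq
    exact (h.mem_of_crosses e he a s t hst hs ht hcross).2

lemma comparable (h : Admissible T G) (hf : f ∈ flipsBelow G) (hg : g ∈ flipsBelow G)
    (hc : Crosses f.new g.new) : IsAncestor f.new g.new ∨ IsAncestor g.new f.new := by
  obtain ⟨-, e, he, ha⟩ := hf
  obtain ⟨-, e', he', ha'⟩ := hg
  exact ha.comparable ha' (h.isEdge e he) (h.isEdge e' he') (h.not_crosses e he e' he') hc

lemma isAncestor_of_isFareySide_old (h : Admissible T G) (hf : f ∈ flipsBelow G)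
    (hg : g ∈ flipsBelow G) (hs : IsFareySide f.old g.new) : IsAncestor g.new f.new := by
  rcases hs.crosses_or_isAncestor hf.1.isEdge_new hf.1.crosses with hcross | hanc
  · refine (h.comparable hf hg hcross).resolve_left fun hanc => ?_
    rcases hanc.crosses_or_isAncestor hs.isEdge hf.1.crosses.symm with hcross' | hanc'
    · exact hs.not_crosses hcross'.symm
    · exact hf.1.not_isAncestor_new_old hanc'
  · exact hanc

lemma eq_of_old_eq (h : Admissible T G) (hf : f ∈ flipsBelow G) (hg : g ∈ flipsBelow G)
    (hold : f.old = g.old) : f = g := by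
  by_contra hne
  rcases h.comparable hf hg (hf.1.crosses_of_old_eq hg.1 hold hne) with hanc | hanc
  · exact hf.1.not_isAncestor_of_old_eq hg.1 hold hne hanc
  · exact hg.1.not_isAncestor_of_old_eq hf.1 hold.symm (Ne.symm hne) hanc

/-- The removed diagonal and the sides of the parallelogram are present when the turn of `g` comes:
they belong to `T` or have been inserted, and they have not been removed again, since a flip that
removes a side of the parallelogram is above `g`. -/
lemma canFlip (h : Admissible T G) {l' : List Flip}
    (hl : (planOf G).IsLinearOrdering (l ++ g :: l')) : CanFlip (applyFlips T l) g := by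
  have hg : g ∈ flipsBelow G := (hl.1.2 g).mp (by simp)
  have hlG : ∀ f ∈ l, f ∈ flipsBelow G := fun f hf => (hl.1.2 f).mp (by simp [hf])
  refine hg.1.canFlip (mem_applyFlips ?_ fun f hf hold => ?_)
    fun k hk => mem_applyFlips ?_ fun f hf hold => ?_
  · by_cases hlen : edgeLen g.old = 1
    · exact Or.inl (h.old_mem hg hlen)
    · refine Or.inr (exists_mem_left_of_isAncestor hl ?_ ?_ hlen)
      · exact hg.1.edgeLen_old_eq_one_or_isAncestor.resolve_left hlen
      · exact fun heq => hg.1.edgeLen_old_lt.ne (congrArg edgeLen heq)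
  · obtain rfl := h.eq_of_old_eq (hlG f hf) hg hold
    exact not_isAncestor_of_mem_left hl hf .refl
  · by_cases hlen : edgeLen k = 1
    · exact Or.inl (h.mem_of_isAncestor hg hk.isAncestor hlen)
    · refine Or.inr (exists_mem_left_of_isAncestor hl hk.isAncestor ?_ hlen)
      exact fun heq => hk.edgeLen_lt.ne (congrArg edgeLen heq)
  · subst hold
    exact not_isAncestor_of_mem_left hl hf (h.isAncestor_of_isFareySide_old (hlG f hf) hg hk)

lemma generates (h : Admissible T G) (hl : (planOf G).IsLinearOrdering l) : Generates T G l := by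
  refine ⟨isFlipPath_of_forall_canFlip fun l₁ f l₂ heq => h.canFlip (heq ▸ hl),
    fun e he => mem_applyFlips ?_ fun f hf hold => ?_⟩
  · by_cases hlen : edgeLen e = 1
    · exact Or.inl (h.mem_of_edgeLen_eq_one e he hlen)
    · obtain ⟨f, hf, rfl⟩ := h.exists_isFareyFlip e he hlen
      exact Or.inr ⟨f, (hl.1.2 f).mpr ⟨hf, _, he, .refl⟩, rfl⟩
  · subst hold
    obtain ⟨hfarey, e', he', hanc⟩ := (hl.1.2 f).mp hf
    rcases hanc.crosses_or_isAncestor (h.isEdge _ he) hfarey.crosses.symm with hcross | hanc'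
    · exact h.not_crosses _ he _ he' hcross
    · exact hfarey.not_isAncestor_new_old hanc'

lemma mem_of_generates (h : Admissible T G) (hl : Generates T G l) (hf : f ∈ flipsBelow G) :
    f ∈ l := by
  obtain ⟨hfarey, e, he, hanc⟩ := hf
  exact hl.1.mem_of_isAncestor h.edgeLen_eq_one (hl.2 he) hfarey hanc

lemma isLinearOrdering (h : Admissible T G) (hl : IsFlipPath T l)
    (hc : (planOf G).ContainsExactly l) : (planOf G).IsLinearOrdering l := by
  refine ⟨hc, List.pairwise_of_forall_sublist fun {f g} hsub => ?_⟩
  rintro ⟨hg, -, hanc⟩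
  obtain ⟨r₁, r₂, rfl, hf, hgr⟩ := List.cons_sublist_iff.mp hsub
  obtain ⟨l₁, l₂, rfl⟩ := List.append_of_mem hf
  have hsplit : l₁ ++ f :: l₂ ++ r₂ = (l₁ ++ [f]) ++ (l₂ ++ r₂) := by simp
  rw [hsplit] at hl hc
  have hnew : f.new ∈ applyFlips T (l₁ ++ [f]) := by
    rw [applyFlips_append]
    exact Or.inr rfl
  have hmem := (isFlipPath_append.mp hl).1.mem_of_isAncestor h.edgeLen_eq_one hnew hg.1 hanc
  exact List.disjoint_of_nodup_append hc.1 hmem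
    (List.mem_append_right _ (List.singleton_sublist.mp hgr))

lemma subperm_of_generates (h : Admissible T G) (hl : (planOf G).IsLinearOrdering l)
    {l' : List Flip} (hl' : Generates T G l') : l.Subperm l' :=
  List.subperm_of_subset hl.1.1 fun f hf => h.mem_of_generates hl' ((hl.1.2 f).mp hf)

theorem isMinFlipPath (h : Admissible T G) (hl : (planOf G).IsLinearOrdering l) :
    IsMinFlipPath T G l :=
  ⟨h.generates hl, fun _ hl' => (h.subperm_of_generates hl hl').length_le⟩

theorem isMinFlipPlan (h : Admissible T G) : IsMinFlipPlan T G (planOf G) :=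
  ⟨⟨isPoset_planOf h.finite, fun _ => ⟨fun hl => ⟨h.generates hl, hl.1⟩,
    fun hl => h.isLinearOrdering hl.1.1 hl.2⟩⟩, fun _ hl => h.isMinFlipPath hl⟩

theorem isUniqueMinFlipPlan (h : Admissible T G) : IsUniqueMinFlipPlan T G (planOf G) := by
  refine ⟨h.isMinFlipPlan, fun π' ⟨⟨hposet', hplan'⟩, hmin'⟩ => ?_⟩
  obtain ⟨⟨hposet, hplan⟩, -⟩ := h.isMinFlipPlan
  have hflips : π'.flips = (planOf G).flips := by
    obtain ⟨l, hl⟩ := hposet.exists_isLinearOrdering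
    obtain ⟨l', hl'⟩ := hposet'.exists_isLinearOrdering
    obtain ⟨hgen', hshortest⟩ := hmin' l' hl'
    have hperm := (h.subperm_of_generates hl hgen').perm_of_length_le
      (hshortest l (h.generates hl))
    ext f
    rw [← hl'.1.2 f, ← hl.1.2 f, hperm.mem_iff]
  refine hposet.eq_of_isLinearOrdering_iff hposet' hflips fun l => ?_
  simp only [hplan', hplan, FlipPoset.ContainsExactly, hflips]

end Admissible

/-! ### The algorithms compute the plans -/

namespace IsAcute

variable {s w a : Pt}

lemma eq_or_eq_of_isLongFareySide (h : IsAcute s (w - s)) (hlt : sqLen (w - s) < sqLen s)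
    {k : Edge} (hk : IsLongFareySide k s(a, a + w)) :
    k = s(a, a + s) ∨ k = s(a + (w - s), a + (w - s) + s) := by
  obtain ⟨t, rfl⟩ : ∃ t, w = s + t := ⟨w - s, by abel⟩
  rw [add_sub_cancel_left] at *
  obtain ⟨a', s', t', h', hlt', rfl, he⟩ := hk
  rcases h.parallelogram_unique h' he.symm with ⟨rfl, rfl, rfl⟩ | ⟨rfl, rfl, rfl⟩ |
    ⟨rfl, rfl, rfl⟩ | ⟨rfl, rfl, rfl⟩
  · exact Or.inl rfl
  · omega
  · exact Or.inr (edge_congr_swap (by abel) (by abel))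
  · rw [sqLen_neg, sqLen_neg] at hlt'; omega

lemma isFareySide_near (h : IsAcute s (w - s)) : IsFareySide s(a, a + s) s(a, a + w) :=
  h.isFareySide_left rfl (by abel)

lemma isFareySide_far (h : IsAcute s (w - s)) :
    IsFareySide s(a + (w - s), a + (w - s) + s) s(a, a + w) := by
  rw [show a + (w - s) + s = a + w by abel]
  exact h.symm.isFareySide_right rfl (by abel)

lemma isAncestor_iff (h : IsAcute s (w - s)) (hlt : sqLen (w - s) < sqLen s) {g : Edge}
    (hg : edgeLen g ≠ 1) : IsAncestor g s(a, a + w) ↔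
      g = s(a, a + w) ∨ IsAncestor g s(a, a + s) ∨
        IsAncestor g s(a + (w - s), a + (w - s) + s) := by
  constructor
  · intro hanc
    rcases hanc.eq_or_exists_isLongFareySide hg with heq | ⟨k, hk, hgk⟩
    · exact Or.inl heq
    · rcases h.eq_or_eq_of_isLongFareySide hlt hk with rfl | rfl
      · exact Or.inr (Or.inl hgk)
      · exact Or.inr (Or.inr hgk)
  · rintro (rfl | hanc | hanc)
    · exact .refl
    · exact hanc.tail h.isFareySide_near
    · exact hanc.tail h.isFareySide_far

lemma isAncestor_iff_of_unit (h : IsAcute s (w - s)) (hs : sqLen s = 1) (ht : sqLen (w - s) = 1)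
    {g : Edge} (hg : edgeLen g ≠ 1) : IsAncestor g s(a, a + w) ↔ g = s(a, a + w) := by
  refine ⟨fun hanc => (hanc.eq_or_exists_isLongFareySide hg).resolve_right ?_, .of_eq⟩
  rintro ⟨_, ⟨a', s', t', h', hlt', rfl, he⟩, -⟩
  obtain ⟨t, rfl⟩ : ∃ t, w = s + t := ⟨w - s, by abel⟩
  rw [add_sub_cancel_left] at *
  rcases h.parallelogram_unique h' he.symm with ⟨-, rfl, rfl⟩ | ⟨-, rfl, rfl⟩ | ⟨-, rfl, rfl⟩ |
    ⟨-, rfl, rfl⟩ <;> simp only [sqLen_neg, hs, ht, lt_self_iff_false] at hlt'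

end IsAcute

/-- The list of fractions, mapped to lattice vectors by `φ`, is a reversed Farey plan: it ends with
the sum of two unit vectors, and every other fraction `f` is followed by the fraction `g` for which
`φ g` is the longer side of the Farey parallelogram with diagonal `φ f`. -/
inductive IsParentChain (φ : ℕ × ℕ → Pt) : List (ℕ × ℕ) → Prop
  | singleton {f : ℕ × ℕ} (hA : IsAcute (φ (0, 1)) (φ f - φ (0, 1))) (hs : sqLen (φ (0, 1)) = 1)
      (ht : sqLen (φ f - φ (0, 1)) = 1) : IsParentChain φ [f]
  | cons {f g : ℕ × ℕ} {C : List (ℕ × ℕ)} (hA : IsAcute (φ g) (φ f - φ g))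
      (hlt : sqLen (φ f - φ g) < sqLen (φ g)) (hC : IsParentChain φ (g :: C)) :
      IsParentChain φ (f :: g :: C)

namespace IsParentChain

variable {φ : ℕ × ℕ → Pt} {f : ℕ × ℕ} {C : List (ℕ × ℕ)}

lemma isFareyFlip_rootFlip (h : IsParentChain φ (f :: C)) (v : Pt) :
    IsFareyFlip (rootFlip φ f C v) := by
  cases h with
  | singleton hA => exact ⟨v, _, _, hA, by rw [rootFlip, List.headD_nil, add_sub_cancel]⟩
  | cons hA => exact ⟨v, _, _, hA, by rw [rootFlip, List.headD_cons, add_sub_cancel]⟩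

lemma eq_rootFlip_iff (hC : IsParentChain φ (f :: C)) {x : Flip} (hF : IsFareyFlip x) (v : Pt) :
    x = rootFlip φ f C v ↔ x.new = s(v, v + φ f) :=
  ⟨fun heq => heq ▸ rfl, hF.ext_new (hC.isFareyFlip_rootFlip v)⟩

lemma isFareyFlip_of_mem_planFlips (hC : IsParentChain φ C) {v : Pt} {x : Flip}
    (hx : x ∈ planFlips φ C v) : IsFareyFlip x := by
  induction hC generalizing v with
  | singleton hA hs ht =>
    simp only [planFlips, Set.union_empty, Set.mem_singleton_iff] at hx
    exact hx ▸ (singleton hA hs ht).isFareyFlip_rootFlip v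
  | cons hA hlt hC ih =>
    rw [planFlips] at hx
    rcases hx with (rfl | hx) | hx
    · exact (cons hA hlt hC).isFareyFlip_rootFlip v
    · exact ih hx
    · exact ih hx

lemma mem_planFlips_iff_isAncestor (hC : IsParentChain φ (f :: C)) {x : Flip} (hF : IsFareyFlip x)
    (v : Pt) : x ∈ planFlips φ (f :: C) v ↔ IsAncestor x.new s(v, v + φ f) := by
  have hne := hF.one_lt_edgeLen_new.ne'
  induction C generalizing f v with
  | nil =>
    rw [planFlips, planFlips, planFlips, Set.union_empty, Set.union_empty, Set.mem_singleton_iff,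
      hC.eq_rootFlip_iff hF]
    cases hC with
    | singleton hA hs ht => rw [hA.isAncestor_iff_of_unit hs ht hne]
  | cons g C ih =>
    rw [planFlips, Set.mem_union, Set.mem_union, Set.mem_singleton_iff, hC.eq_rootFlip_iff hF,
      List.headD_cons]
    cases hC with
    | cons hA hlt hC =>
      simp only [ih hC, hA.isAncestor_iff hlt hne, or_assoc]

theorem mem_planFlips (hC : IsParentChain φ (f :: C)) (v : Pt) (x : Flip) :
    x ∈ planFlips φ (f :: C) v ↔ IsFareyFlip x ∧ IsAncestor x.new s(v, v + φ f) :=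
  ⟨fun hx => have hF := hC.isFareyFlip_of_mem_planFlips hx
    ⟨hF, (hC.mem_planFlips_iff_isAncestor hF v).mp hx⟩,
    fun hx => (hC.mem_planFlips_iff_isAncestor hx.1 v).mpr hx.2⟩

lemma isFareySide_of_mem_planArcs (hC : IsParentChain φ C) {v : Pt} {x : Flip × Flip}
    (hx : x ∈ planArcs φ C v) : IsFareySide x.1.new x.2.new := by
  induction hC generalizing v with
  | singleton => simp [planArcs] at hx
  | cons hA _ _ ih =>
    rw [planArcs] at hx
    rcases hx with ((rfl | rfl) | hx) | hx
    · exact hA.isFareySide_near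
    · exact hA.isFareySide_far
    · exact ih hx
    · exact ih hx

lemma mem_planArcs (hC : IsParentChain φ C) {v : Pt} {f' g' : Flip} (hg : g' ∈ planFlips φ C v)
    (hf : IsFareyFlip f') (hl : IsLongFareySide f'.new g'.new) : (f', g') ∈ planArcs φ C v := by
  induction hC generalizing v with
  | singleton hA hs ht =>
    have hanc := (((singleton hA hs ht).mem_planFlips v g').mp hg).2
    have hne := hf.one_lt_edgeLen_new.ne'
    have hlt := hl.isFareySide.edgeLen_lt
    have hf' := (hA.isAncestor_iff_of_unit hs ht hne).mp (hl.isFareySide.isAncestor.trans hanc)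
    have := hanc.edgeLen_le
    rw [hf'] at hlt
    omega
  | cons hA hlt hC ih =>
    rw [planFlips] at hg
    rw [planArcs]
    rcases hg with (rfl | hg) | hg
    · left; left
      rcases hA.eq_or_eq_of_isLongFareySide hlt hl with hnew | hnew
      · exact Or.inl (Prod.ext ((hC.eq_rootFlip_iff hf _).mpr hnew) rfl)
      · exact Or.inr (Prod.ext ((hC.eq_rootFlip_iff hf _).mpr hnew) rfl)
    · exact Or.inl (Or.inr (ih hg))
    · exact Or.inr (ih hg)

end IsParentChain

lemma mediant_lt_iff {lo hi : ℕ × ℕ} (hdet : hi.1 * lo.2 = lo.1 * hi.2 + 1) (α β : ℕ) :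
    (lo + hi).1 * (α • lo + β • hi).2 < (α • lo + β • hi).1 * (lo + hi).2 ↔ α < β := by
  have hdiff : ((lo + hi).1 * (α • lo + β • hi).2 : ℤ) - (α • lo + β • hi).1 * (lo + hi).2 =
      α - β := by
    zify at hdet
    simp only [Prod.fst_add, Prod.snd_add, Prod.smul_fst, Prod.smul_snd, smul_eq_mul]
    push_cast
    linear_combination (α - β : ℤ) * hdet
  zify
  constructor <;> intro h <;> linarith

/-- The invariant is that the target `f` lies in the cone of the neighboring fractions `lo` and
`hi`, with coefficients that decrease as in the subtractive Euclidean algorithm. -/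
lemma exists_isParentChain_fareySteps {φ : ℕ × ℕ → Pt} (hφ : ∀ a b, φ (a + b) = φ a + φ b)
    {f : ℕ × ℕ} (k : ℕ) {lo hi : ℕ × ℕ} {acc : List (ℕ × ℕ)} {α β : ℕ} (hα : 1 ≤ α) (hβ : 1 ≤ β)
    (hαk : α ≤ k) (hβk : β ≤ k) (hcop : Nat.Coprime α β) (hf : f = α • lo + β • hi)
    (hdet : hi.1 * lo.2 = lo.1 * hi.2 + 1) (hA : IsAcute (φ lo) (φ hi))
    (hacc : IsParentChain φ ((lo + hi) :: acc)) :
    ∃ C, (fareySteps f k lo (lo + hi) hi).reverse ++ acc = f :: C ∧ IsParentChain φ (f :: C) := by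
  induction k generalizing lo hi acc α β with
  | zero => omega
  | succ k ih =>
    rw [fareySteps, List.reverse_cons, List.append_assoc, List.singleton_append]
    split_ifs with hd hlt
    · exact ⟨acc, by rw [hd]; rfl, hd ▸ hacc⟩
    · rw [hf, mediant_lt_iff hdet] at hlt
      obtain ⟨γ, rfl⟩ := Nat.exists_eq_add_of_lt hlt
      refine ih (α := α) (β := γ + 1) hα (by omega) (by omega) (by omega) ?_ (by rw [hf]; module)
        ?_ ?_ (.cons ?_ ?_ hacc)
      · rwa [add_assoc, Nat.coprime_self_add_right] at hcop
      · simp only [Prod.fst_add, Prod.snd_add]; linarith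
      · rw [hφ]; exact hA.add_left
      · rw [hφ (lo + hi) hi, add_sub_cancel_left, hφ]; exact hA.add_left
      · rw [hφ (lo + hi) hi, add_sub_cancel_left, hφ, add_comm]; exact hA.symm.sqLen_left_lt_add
    · rw [hf, mediant_lt_iff hdet] at hlt
      have hne : α ≠ β := by
        rintro rfl
        rw [Nat.coprime_self] at hcop
        exact hd (by rw [hf, hcop, one_smul, one_smul])
      obtain ⟨γ, rfl⟩ := Nat.exists_eq_add_of_lt (show β < α by omega)
      refine ih (α := γ + 1) (β := β) (by omega) hβ (by omega) (by omega) ?_ (by rw [hf]; module)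
        ?_ ?_ (.cons ?_ ?_ hacc)
      · rwa [add_assoc, Nat.coprime_self_add_left] at hcop
      · simp only [Prod.fst_add, Prod.snd_add]; linarith
      · rw [hφ]; exact hA.add_right
      · rw [hφ lo (lo + hi), add_sub_cancel_right, hφ]; exact hA.add_right.symm
      · rw [hφ lo (lo + hi), add_sub_cancel_right, hφ]; exact hA.sqLen_left_lt_add

namespace PlacedEdge

variable (e : PlacedEdge)

lemma coordVec_add (i j i' j' : ℕ) :
    e.coordVec (i + i') (j + j') = e.coordVec i j + e.coordVec i' j' := by
  simp only [coordVec]; push_cast; module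

lemma fareyInv_add (a b : ℕ × ℕ) : e.fareyInv (a + b) = e.fareyInv a + e.fareyInv b := by
  simp only [fareyInv, Prod.fst_add, Prod.snd_add]
  split_ifs <;> exact e.coordVec_add _ _ _ _

lemma fareyInv_fareyFlip : e.fareyInv e.fareyFlip = e.coordVec e.x e.y := by
  simp only [fareyInv, fareyFlip]
  split_ifs <;> rfl

lemma coprime_fareyFlip : Nat.Coprime e.fareyFlip.2 e.fareyFlip.1 := by
  rw [fareyFlip]
  split_ifs
  · exact e.coprime.symm
  · exact e.coprime

lemma fareyFlip_le : e.fareyFlip.1 ≤ e.fareyFlip.2 := by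
  rw [fareyFlip]; split_ifs <;> dsimp only <;> omega

lemma fareyFlip_pos (h : ¬ (e.x = 0 ∨ e.y = 0)) : 1 ≤ e.fareyFlip.1 := by
  rw [fareyFlip]; split_ifs <;> dsimp only <;> omega

lemma isAcute_unitVec (i : Fin 6) : IsAcute (unitVec i) (unitVec (i + 1)) := by
  fin_cases i <;> simp [unitVec, IsAcute, det, dot]

lemma sqLen_unitVec (i : Fin 6) : sqLen (unitVec i) = 1 := by
  fin_cases i <;> simp [unitVec, sqLen]

lemma coordVec_one_zero : e.coordVec 1 0 = unitVec e.sector := by simp [coordVec]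

lemma coordVec_zero_one : e.coordVec 0 1 = unitVec (e.sector + 1) := by simp [coordVec]

lemma isAcute_fareyInv : IsAcute (e.fareyInv (0, 1)) (e.fareyInv (1, 0)) := by
  simp only [fareyInv, coordVec_one_zero, coordVec_zero_one]
  split_ifs
  · exact (isAcute_unitVec _).symm
  · exact isAcute_unitVec _

lemma sqLen_fareyInv : sqLen (e.fareyInv (0, 1)) = 1 ∧ sqLen (e.fareyInv (1, 0)) = 1 := by
  simp only [fareyInv, coordVec_one_zero, coordVec_zero_one]
  split_ifs <;> exact ⟨sqLen_unitVec _, sqLen_unitVec _⟩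

theorem exists_isParentChain (h : ¬ (e.x = 0 ∨ e.y = 0)) :
    ∃ C, (fareyPlan e).reverse = e.fareyFlip :: C ∧
      IsParentChain e.fareyInv (e.fareyFlip :: C) := by
  have hpos := e.fareyFlip_pos h
  have hle := e.fareyFlip_le
  have hbase : IsParentChain e.fareyInv [(0, 1) + (1, 0)] := by
    constructor <;> simp only [fareyInv_add, add_sub_cancel_left, isAcute_fareyInv, sqLen_fareyInv]
  rw [fareyPlan, if_neg h, show ((1, 1) : ℕ × ℕ) = (0, 1) + (1, 0) from rfl]
  simpa only [List.append_nil] using exists_isParentChain_fareySteps e.fareyInv_add e.fareyFlip.2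
    (hpos.trans hle) hpos le_rfl hle e.coprime_fareyFlip (by ext <;> simp) (by simp)
    e.isAcute_fareyInv hbase

lemma edgeLen_toEdge (h : e.x = 0 ∨ e.y = 0) : edgeLen e.toEdge = 1 := by
  have hcop := e.coprime
  rw [toEdge, edgeLen_mk, add_sub_cancel_left]
  rcases h with h | h <;> rw [h] at hcop ⊢
  · rw [(Nat.coprime_zero_left _).mp hcop, coordVec_zero_one, sqLen_unitVec]
  · rw [(Nat.coprime_zero_right _).mp hcop, coordVec_one_zero, sqLen_unitVec]

lemma isEdge_toEdge : IsEdge e.toEdge :=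
  isEdge_of_sub_eq (isAcute_unitVec e.sector).1 (Nat.isCoprime_iff_coprime.mpr e.coprime)
    (add_sub_cancel_left _ _)

lemma exists_isFareyFlip (h : edgeLen e.toEdge ≠ 1) : ∃ f, IsFareyFlip f ∧ f.new = e.toEdge := by
  obtain ⟨C, -, hC⟩ := e.exists_isParentChain fun h0 => h (e.edgeLen_toEdge h0)
  exact ⟨_, hC.isFareyFlip_rootFlip e.origin, by rw [rootFlip, fareyInv_fareyFlip]; rfl⟩

theorem flipSet_eq : flipSet e = flipsBelow {e.toEdge} := by
  ext f
  simp only [flipsBelow, Set.mem_singleton_iff, exists_eq_left, Set.mem_ofPred_eq]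
  by_cases h : e.x = 0 ∨ e.y = 0
  · simp only [flipSet, fareyPlan, if_pos h, List.reverse_nil, planFlips, Set.mem_empty_iff_false,
      false_iff]
    rintro ⟨hf, hanc⟩
    have := hf.one_lt_edgeLen_new
    have := hanc.edgeLen_le
    have := e.edgeLen_toEdge h
    omega
  · obtain ⟨C, hC, hchain⟩ := e.exists_isParentChain h
    rw [flipSet, hC, hchain.mem_planFlips, fareyInv_fareyFlip]; rfl

lemma isFareySide_of_mem_arcSet {x : Flip × Flip} (hx : x ∈ arcSet e) :
    IsFareySide x.1.new x.2.new := by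
  by_cases h : e.x = 0 ∨ e.y = 0
  · simp [arcSet, fareyPlan, if_pos h, planArcs] at hx
  · obtain ⟨C, hC, hchain⟩ := e.exists_isParentChain h
    rw [arcSet, hC] at hx
    exact hchain.isFareySide_of_mem_planArcs hx

lemma mem_arcSet {f g : Flip} (hg : g ∈ flipSet e) (hf : IsFareyFlip f)
    (h : IsLongFareySide f.new g.new) : (f, g) ∈ arcSet e := by
  by_cases h0 : e.x = 0 ∨ e.y = 0
  · simp [flipSet, fareyPlan, if_pos h0, planFlips] at hg
  · obtain ⟨C, hC, hchain⟩ := e.exists_isParentChain h0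
    rw [flipSet, hC] at hg
    rw [arcSet, hC]
    exact hchain.mem_planArcs hg hf h

end PlacedEdge

section OfArcs

variable {G : Set Edge} {A : Set (Flip × Flip)}

lemma isAncestor_of_reflTransGen (hside : ∀ x ∈ A, IsFareySide x.1.new x.2.new) {f g : Flip}
    (h : Relation.ReflTransGen (fun s t => (s, t) ∈ A) f g) : IsAncestor f.new g.new :=
  h.lift Flip.new fun _ _ harc => hside _ harc

lemma reflTransGen_of_isAncestor
    (hlong : ∀ f g, g ∈ flipsBelow G → IsFareyFlip f → IsLongFareySide f.new g.new → (f, g) ∈ A)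
    {f g : Flip} (hf : IsFareyFlip f) (hg : g ∈ flipsBelow G) (h : IsAncestor f.new g.new) :
    Relation.ReflTransGen (fun s t => (s, t) ∈ A) f g := by
  induction hn : (edgeLen g.new).toNat using Nat.strong_induction_on generalizing g with
  | _ n ih =>
    rcases h.eq_or_exists_isLongFareySide hf.one_lt_edgeLen_new.ne' with heq | ⟨k, hk, hfk⟩
    · rw [hf.ext_new hg.1 heq]
    · have hside := hk.isFareySide
      obtain ⟨f', hf', rfl⟩ :=
        hside.edgeLen_eq_one_or_exists_isFareyFlip.resolve_left hk.one_lt_edgeLen.ne'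
      have hmem := mem_flipsBelow_of_isAncestor hg hf' hside.isAncestor
      exact (ih _ (hn ▸ hside.toNat_edgeLen_lt) hmem hfk rfl).tail (hlong _ _ hg hf' hk)

theorem ofArcs_eq_planOf (hside : ∀ x ∈ A, IsFareySide x.1.new x.2.new)
    (hlong : ∀ f g, g ∈ flipsBelow G → IsFareyFlip f → IsLongFareySide f.new g.new → (f, g) ∈ A) :
    FlipPoset.ofArcs (flipsBelow G) A = planOf G := by
  ext f g
  · rfl
  · exact and_congr_right fun hf => and_congr_right fun hg =>
      ⟨isAncestor_of_reflTransGen hside, reflTransGen_of_isAncestor hlong hf.1 hg⟩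

end OfArcs

theorem flipPlan_eq (e : PlacedEdge) : flipPlan e = planOf {e.toEdge} := by
  rw [flipPlan, e.flipSet_eq]
  exact ofArcs_eq_planOf (fun _ => e.isFareySide_of_mem_arcSet)
    fun f g hg hf h => e.mem_arcSet (by rwa [e.flipSet_eq]) hf h

lemma flipsBelow_eq_biUnion (G : Set Edge) : flipsBelow G = ⋃ e ∈ G, flipsBelow {e} := by
  ext f
  simp only [flipsBelow, Set.mem_singleton_iff, exists_eq_left, Set.mem_ofPred_eq, Set.mem_iUnion,
    exists_prop]
  exact ⟨fun ⟨h, e, he, hanc⟩ => ⟨e, he, h, hanc⟩, fun ⟨e, he, h, hanc⟩ => ⟨h, e, he, hanc⟩⟩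

theorem multiFlipPlan_eq (E : Finset PlacedEdge) :
    multiFlipPlan E = planOf {g | ∃ e ∈ E, e.toEdge = g} := by
  have hF : ⋃ e ∈ E, flipSet e = flipsBelow {g | ∃ e ∈ E, e.toEdge = g} := by
    ext f
    rw [flipsBelow_eq_biUnion]
    simp [PlacedEdge.flipSet_eq]
  rw [multiFlipPlan, hF]
  refine ofArcs_eq_planOf ?_ ?_
  · intro x hx
    simp only [Set.mem_iUnion] at hx
    obtain ⟨e, -, hx⟩ := hx
    exact e.isFareySide_of_mem_arcSet hx
  · intro f g hg hf h
    rw [← hF] at hg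
    simp only [Set.mem_iUnion] at hg ⊢
    obtain ⟨e, he, hg⟩ := hg
    exact ⟨e, he, e.mem_arcSet hg hf h⟩

/-! ### Sequential generation -/

lemma Admissible.mono {T G G' : Set Edge} (h : Admissible T G) (hG : G' ⊆ G) :
    Admissible T G' where
  edgeLen_eq_one := h.edgeLen_eq_one
  finite := h.finite.subset hG
  isEdge e he := h.isEdge e (hG he)
  not_crosses e he e' he' := h.not_crosses e (hG he) e' (hG he')
  mem_of_edgeLen_eq_one e he := h.mem_of_edgeLen_eq_one e (hG he)
  exists_isFareyFlip e he := h.exists_isFareyFlip e (hG he)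
  mem_of_crosses e he := h.mem_of_crosses e (hG he)

theorem IsEquilateralTriangulation.admissible {Ω : LatticePolygon} {T₀ : Set Edge}
    (hT₀ : IsEquilateralTriangulation Ω T₀) {E : Finset PlacedEdge}
    (hΩ : ∀ e ∈ E, seg e.toEdge ⊆ Ω.region)
    (hE : ∀ e ∈ E, ∀ e' ∈ E, e.toEdge ≠ e'.toEdge → NonCrossing e.toEdge e'.toEdge) :
    Admissible T₀ {g | ∃ e ∈ E, e.toEdge = g} where
  edgeLen_eq_one _ he := hT₀.edgeLen_eq_one he
  finite := E.finite_toSet.image PlacedEdge.toEdge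
  isEdge := by rintro _ ⟨e, -, rfl⟩; exact e.isEdge_toEdge
  not_crosses := by
    rintro _ ⟨e, he, rfl⟩ _ ⟨e', he', rfl⟩
    by_cases h : e.toEdge = e'.toEdge
    · rw [h]; exact not_crosses_self _
    · exact (hE e he e' he' h).not_crosses e.isEdge_toEdge
  mem_of_edgeLen_eq_one := by
    rintro _ ⟨e, he, rfl⟩ h
    exact hT₀.mem_of_edgeLen_eq_one (hΩ e he) h
  exists_isFareyFlip := by rintro _ ⟨e, -, rfl⟩ h; exact e.exists_isFareyFlip h
  mem_of_crosses := by
    rintro _ ⟨e, he, rfl⟩ a s t hst hs ht hc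
    exact hT₀.mem_of_crosses (hΩ e he) hst hs ht hc

lemma FlipPoset.IsPoset.remove {π : FlipPoset} (h : π.IsPoset) (D : Set Flip) :
    (π.remove D).IsPoset where
  finite := h.finite.subset Set.sdiff_subset
  mem_of_le f g hfg :=
    ⟨⟨(h.mem_of_le f g hfg.2.2).1, hfg.1⟩, ⟨(h.mem_of_le f g hfg.2.2).2, hfg.2.1⟩⟩
  refl f hf := ⟨hf.2, hf.2, h.refl f hf.1⟩
  trans f g k hfg hgk := ⟨hfg.1, hgk.2.1, h.trans f g k hfg.2.2 hgk.2.2⟩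
  antisymm f g hfg hgf := h.antisymm f g hfg.2.2 hgf.2.2

lemma FlipPoset.remove_empty (π : FlipPoset) : π.remove ∅ = π := by
  ext <;> simp [FlipPoset.remove]

theorem exists_isSequentialOrdering (D : Set Flip) (es : List PlacedEdge) :
    ∃ ls, IsSequentialOrdering D es ls := by
  induction es generalizing D with
  | nil => exact ⟨[], trivial⟩
  | cons e es ih =>
    have hposet : (flipPlan e).IsPoset := by
      rw [flipPlan_eq]; exact isPoset_planOf (Set.finite_singleton _)
    obtain ⟨l, hl⟩ := (hposet.remove D).exists_isLinearOrdering
    obtain ⟨ls, hls⟩ := ih (D ∪ (flipPlan e).flips)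
    exact ⟨l :: ls, hl, hls⟩

lemma flipsBelow_union (G G' : Set Edge) :
    flipsBelow (G ∪ G') = flipsBelow G ∪ flipsBelow G' := by
  rw [flipsBelow_eq_biUnion, Set.biUnion_union, ← flipsBelow_eq_biUnion, ← flipsBelow_eq_biUnion]

lemma isLinearOrdering_append {G G' : Set Edge} {D : Set Flip} {l l' : List Flip}
    (hl : ((planOf G).remove D).IsLinearOrdering l)
    (hl' : ((planOf G').remove (D ∪ flipsBelow G)).IsLinearOrdering l') :
    ((planOf (G ∪ G')).remove D).IsLinearOrdering (l ++ l') := by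
  obtain ⟨⟨hnodup, hmem⟩, hpair⟩ := hl
  obtain ⟨⟨hnodup', hmem'⟩, hpair'⟩ := hl'
  change ∀ f, f ∈ l ↔ f ∈ flipsBelow G ∧ f ∉ D at hmem
  change ∀ f, f ∈ l' ↔ f ∈ flipsBelow G' ∧ f ∉ D ∪ flipsBelow G at hmem'
  have hnot : ∀ f ∈ l', f ∉ flipsBelow G := fun f hf h => ((hmem' f).mp hf).2 (Or.inr h)
  refine ⟨⟨hnodup.append hnodup' fun f hf hf' => hnot f hf' ((hmem f).mp hf).1, fun f => ?_⟩,
    List.pairwise_append.mpr ⟨?_, ?_, fun f hf g hg hle => ?_⟩⟩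
  · change _ ↔ f ∈ flipsBelow (G ∪ G') ∧ f ∉ D
    rw [List.mem_append, hmem, hmem', flipsBelow_union, Set.mem_union, Set.mem_union]
    tauto
  · refine hpair.imp_of_mem fun {f g} hf hg hnle hle => hnle ?_
    exact ⟨hle.1, hle.2.1, ((hmem g).mp hg).1, ((hmem f).mp hf).1, hle.2.2.2.2⟩
  · refine hpair'.imp_of_mem fun {f g} hf hg hnle hle => hnle ?_
    have hf := (hmem' f).mp hf
    have hg := (hmem' g).mp hg
    exact ⟨hg.2, hf.2, hg.1, hf.1, hle.2.2.2.2⟩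
  · have hg' := ((hmem' g).mp hg).1.1
    exact hnot g hg (mem_flipsBelow_of_isAncestor ((hmem f).mp hf).1 hg' hle.2.2.2.2)

namespace IsSequentialOrdering

lemma take {D : Set Flip} {es : List PlacedEdge} {ls : List (List Flip)}
    (h : IsSequentialOrdering D es ls) (k : ℕ) :
    IsSequentialOrdering D (es.take k) (ls.take k) := by
  induction k generalizing D es ls with
  | zero => trivial
  | succ k ih =>
    match es, ls, h with
    | [], [], _ => trivial
    | _ :: _, _ :: _, ⟨hl, hls⟩ => exact ⟨hl, ih hls⟩

lemma isLinearOrdering_remove {D : Set Flip} {es : List PlacedEdge} {ls : List (List Flip)}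
    (h : IsSequentialOrdering D es ls) :
    ((planOf {g | ∃ e ∈ es, e.toEdge = g}).remove D).IsLinearOrdering ls.flatten := by
  induction es generalizing D ls with
  | nil =>
    match ls, h with
    | [], _ => exact ⟨⟨List.nodup_nil, by simp [FlipPoset.remove, planOf, flipsBelow]⟩, .nil⟩
  | cons e es ih =>
    match ls, h with
    | l :: ls, ⟨hl, hls⟩ =>
      rw [flipPlan_eq] at hl hls
      have hunion : {g | ∃ e' ∈ e :: es, e'.toEdge = g} =
          {e.toEdge} ∪ {g | ∃ e' ∈ es, e'.toEdge = g} := by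
        ext g
        simp [eq_comm]
      rw [hunion, List.flatten_cons]
      exact isLinearOrdering_append hl (ih hls)

theorem isLinearOrdering {es : List PlacedEdge} {ls : List (List Flip)}
    (h : IsSequentialOrdering ∅ es ls) :
    (planOf {g | ∃ e ∈ es, e.toEdge = g}).IsLinearOrdering ls.flatten := by
  simpa only [FlipPoset.remove_empty] using h.isLinearOrdering_remove

end IsSequentialOrdering

theorem GeneratesSequentially.of_isSequentialOrdering {T₀ : Set Edge} {es : List PlacedEdge}
    {ls : List (List Flip)} (hA : Admissible T₀ {g | ∃ e ∈ es, e.toEdge = g})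
    (hls : IsSequentialOrdering ∅ es ls) : GeneratesSequentially T₀ es ls := by
  refine ⟨(hA.generates hls.isLinearOrdering).1, fun k _ e he => ?_⟩
  have hsub : {g | ∃ e ∈ es.take k, e.toEdge = g} ⊆ {g | ∃ e ∈ es, e.toEdge = g} :=
    fun _ ⟨e, he, heq⟩ => ⟨e, List.mem_of_mem_take he, heq⟩
  exact ((hA.mono hsub).generates (hls.take k).isLinearOrdering).2 ⟨e, he, rfl⟩

end LatticeFlip

theorem mainTheorem6 (Ω : LatticePolygon) (T₀ : Set Edge)
    (hT₀ : IsEquilateralTriangulation Ω T₀) (E : Finset PlacedEdge)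
    (hΩ : ∀ e ∈ E, seg e.toEdge ⊆ Ω.region)
    (hE : ∀ e ∈ E, ∀ e' ∈ E, e.toEdge ≠ e'.toEdge → NonCrossing e.toEdge e'.toEdge) :
    (∀ e ∈ E, IsUniqueMinFlipPlan T₀ {e.toEdge} (flipPlan e)) ∧
    IsUniqueMinFlipPlan T₀ {g | ∃ e ∈ E, e.toEdge = g} (multiFlipPlan E) ∧
    ∀ es : List PlacedEdge, es.Nodup → (∀ e, e ∈ es ↔ e ∈ E) →
      (∃ ls, IsSequentialOrdering ∅ es ls) ∧
      ∀ ls, IsSequentialOrdering ∅ es ls →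
        GeneratesSequentially T₀ es ls ∧
        IsMinFlipPath T₀ {g | ∃ e ∈ E, e.toEdge = g} ls.flatten := by
  have hA := hT₀.admissible hΩ hE
  refine ⟨fun e he => ?_, ?_, fun es _ hes => ⟨exists_isSequentialOrdering ∅ es, fun ls hls => ?_⟩⟩
  · rw [flipPlan_eq]
    exact (hA.mono (by rintro _ rfl; exact ⟨e, he, rfl⟩)).isUniqueMinFlipPlan
  · rw [multiFlipPlan_eq]
    exact hA.isUniqueMinFlipPlan
  · simp only [← hes] at hA ⊢
    exact ⟨.of_isSequentialOrdering hA hls, hA.isMinFlipPath hls.isLinearOrdering⟩
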